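/- Let $P$ be a simple polygon in the Euclidean plane, i.e. a closed polygonal path with vertices $w_1,\dots,w_n$ ($n\ge 3$, indices modulo $n$) whose edges $\overline{w_i w_{i+1}}$ are nondegenerate segments, such that consecutive edges meet only in their common vertex and non-consecutive edges are disjoint. Write $\partial P$ for the union of its edges, and identify $P$ with the closed region consisting of $\partial P$ and of all points enclosed by $\partial P$ (the points of the bounded components of the complement of $\partial P$). A vertex of $P$ is called reflex if the interior angle of $P$ at it is at least $\pi$ (so the angle $\pi$ is allowed). A polygonal path $B\subset\partial P$ between two distinct vertices of $P$ is called outward convex if every vertex of $P$ on $B$ other than its two endpoints is reflex; the interior points of $B$ are its points other than its two endpoints. A point $p\in\partial P$ is called strongly visible in $P$ from a point $q\in\partial P$ if the segment $\overline{pq}$ is contained in $P$ and meets $\partial P$ only at its endpoints $p$ and $q$. Suppose that $\partial P$ is partitioned into three polygonal paths $B_1,B_2,B_3$ between vertices of $P$, in the sense that $$B_1\cup B_2\cup B_3=\partial P,\qquad B_1\cap B_2=\{v_1\},\qquad B_2\cap B_3=\{v_2\},\qquad B_3\cap B_1=\{v_3\}$$ for distinct vertices $v_1,v_2,v_3$ of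 $P$, and that each of $B_1,B_2,B_3$ is outward convex. Then for all $i,j\in\{1,2,3\}$ with $i\ne j$, every interior point of $B_i$ is strongly visible in $P$ from some interior point of $B_j$. -/

import Mathlib

open scoped Topology

noncomputable section

/-- The Euclidean plane. -/
abbrev Plane : Type := EuclideanSpace ℝ (Fin 2)

namespace Polygon

variable {n : ℕ}

/-- A simple polygon: a closed polygonal path with at least three vertices and nondegenerate
edges, in which two consecutive edges meet only in their common vertex and two non-consecutive
edges do not meet at all. -/
structure IsSimple (P : Polygon Plane n) : Prop where
  three_le : 3 ≤ n
  nondegenerate : P.HasNondegenerateEdges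
  consecutive : ∀ i : Fin n,
    P.edgeSet ℝ i ∩ P.edgeSet ℝ (finRotate n i) = {P.vertices (finRotate n i)}
  nonconsecutive : ∀ i j : Fin n, i ≠ j → j ≠ finRotate n i → i ≠ finRotate n j →
    Disjoint (P.edgeSet ℝ i) (P.edgeSet ℝ j)

/-- The points enclosed by the polygon: the union of the bounded connected components of the
complement of its boundary. -/
def inside (P : Polygon Plane n) : Set Plane :=
  {x | x ∉ P.boundary ℝ ∧ Bornology.IsBounded (connectedComponentIn (P.boundary ℝ)ᶜ x)}

/-- The closed region that the polygon bounds (the polygon as a subset of the plane). -/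
def region (P : Polygon Plane n) : Set Plane :=
  P.boundary ℝ ∪ P.inside

open Classical in
/-- The interior angle at the vertex `k` with neighbours `a` and `b`: the one of the two angles
`∠ a v b` and `2π - ∠ a v b` between the two edges at `v` that faces the inside of the polygon.
It is the smaller one exactly if the points near `v` in the direction
`(a - v) + (b - v)`, which lies between the two edges, are inside. If `∠ a v b = π`, both are `π`. -/
def interiorAngle (P : Polygon Plane n) (k : Fin n) : ℝ :=
  let a := P.vertices ((finRotate n).symm k)
  let v := P.vertices k
  let b := P.vertices (finRotate n k)
  if ∀ᶠ t : ℝ in 𝓝[>] 0, v + t • ((a - v) + (b - v)) ∈ P.inside then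
    EuclideanGeometry.angle a v b
  else
    2 * Real.pi - EuclideanGeometry.angle a v b

/-- A vertex is reflex if its interior angle is at least `π`. -/
def IsReflex (P : Polygon Plane n) (k : Fin n) : Prop :=
  Real.pi ≤ P.interiorAngle k

/-- A polygonal path in the boundary of `P` between two distinct vertices of `P`: a run of
`length` consecutive edges, the first of which begins at the vertex with index `start`. -/
structure BoundaryPath (P : Polygon Plane n) where
  start : Fin n
  length : ℕ
  length_pos : 0 < length
  length_lt : length < n

namespace BoundaryPath

variable {P : Polygon Plane n}

/-- The index of the `j`-th vertex of the path. -/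
def index (B : P.BoundaryPath) (j : ℕ) : Fin n :=
  (finRotate n)^[j] B.start

/-- The set of all points on the path. -/
def carrier (B : P.BoundaryPath) : Set Plane :=
  ⋃ j ∈ Set.Iio B.length, P.edgeSet ℝ (B.index j)

/-- The interior points of the path: its points other than its two endpoints. -/
def interiorPoints (B : P.BoundaryPath) : Set Plane :=
  B.carrier \ {P.vertices (B.index 0), P.vertices (B.index B.length)}

/-- A path in the boundary is outward convex if each of its interior vertices is reflex. -/
def IsOutwardConvex (B : P.BoundaryPath) : Prop :=
  ∀ j : ℕ, 0 < j → j < B.length → P.IsReflex (B.index j)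

end BoundaryPath

/-- The point `p` is strongly visible in `P` from `q`: the segment between them is contained in
the polygon and meets its boundary only at the endpoints `p` and `q`. -/
def StronglyVisible (P : Polygon Plane n) (p q : Plane) : Prop :=
  segment ℝ p q ⊆ P.region ∧ segment ℝ p q ∩ P.boundary ℝ = {p, q}

end Polygon

end

/-! Identify the plane with `ℂ` and measure everything by signed angles. The winding number of the
boundary is locally constant off the boundary and vanishes far away, so a point of nonzero winding
number lies in a bounded component of the complement. Only this implication is needed, never its
converse.

The exterior angles of a simple polygon sum to `2πσ` with `σ = ±1` (`exists_total_turning_eq`). Near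
a vertex that turns in the sense of `σ`, the points between the two edges have nonzero winding
number (`eventually_winding_ne_zero`), so such a vertex is not reflex. Hence the edge direction,
counted in the sense of `σ`, never increases along the three chains. It gains `2π` in total, and it
can do so only at the three corners, where it gains less than `π` each.

Let `p` lie on an edge of the first chain and take that edge as horizontal. The angle bounds put the
first chain on or below the line of the edge, make the second chain rise strictly to the right of
`p`, and make the third fall strictly to its left (`exists_sees`). Just above `p`, each horizontal
line therefore meets the boundary in exactly two points, one on each of the two other chains. The
winding number is zero outside these two points and jumps at an edge
(`not_eventually_winding_eq_zero`), so it is nonzero between them. Points slightly above `p` on the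
two steep edges are then visible from `p` (`exists_sees_of_frame`). -/

namespace PlanePath

/-! ### Signed turning angles and their additivity -/

open Complex

/-- The signed angle in `(-π, π]` by which one turns from the direction `a` to the direction `b`. -/
noncomputable def turn (a b : ℂ) : ℝ := arg (b / a)

theorem arg_div_of_re_pos {p q : ℂ} (hp : 0 < p.re) (hq : 0 < q.re) :
    arg (q / p) = arg q - arg p := by
  have h1 := abs_lt.1 (abs_arg_lt_pi_div_two_iff.2 (Or.inl hp))
  have h2 := abs_lt.1 (abs_arg_lt_pi_div_two_iff.2 (Or.inl hq))
  have hp0 : p ≠ 0 := by rintro rfl; simp at hp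
  have hq0 : q ≠ 0 := by rintro rfl; simp at hq
  have hinv : arg p⁻¹ = -arg p := by
    rw [arg_inv, if_neg]
    intro h; linarith [Real.pi_pos]
  rw [div_eq_mul_inv, arg_mul hq0 (inv_ne_zero hp0), hinv, sub_eq_add_neg]
  rw [hinv]
  constructor <;> linarith

/-- A real functional is the inner product with some `u`, and `(x / u).re` is that inner product
divided by `normSq u`. Rotating by `u` thus turns an open half-plane into the right one, where `arg`
is additive. -/
theorem exists_re_div_pos (f : ℂ →ₗ[ℝ] ℝ) :
    ∃ u : ℂ, ∀ x, 0 < f x → 0 < (x / u).re ∧ u ≠ 0 := by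
  refine ⟨f 1 + f I * I, fun x hx => ?_⟩
  have hf : f x = x.re * f 1 + x.im * f I := by
    conv_lhs => rw [← re_add_im x]
    rw [map_add, ← mul_one (x.re : ℂ), ← real_smul, ← real_smul, map_smul, map_smul]
    simp
  have hu : (f 1 : ℂ) + f I * I ≠ 0 := by
    intro h
    have h1 := congrArg re h
    have h2 := congrArg im h
    simp at h1 h2
    rw [hf, h1, h2] at hx
    simp at hx
  refine ⟨?_, hu⟩
  have hn := normSq_pos.2 hu
  rw [div_re, ← add_div]
  apply div_pos _ hn
  simp
  linarith

/-- In general turns add only modulo `2π`. Within an open half-plane they are differences of one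
continuous argument, so they add exactly. Every exact angle identity below rests on this. -/
theorem turn_add_of_pos (f : ℂ →ₗ[ℝ] ℝ) {a b c : ℂ} (ha : 0 < f a) (hb : 0 < f b) (hc : 0 < f c) :
    turn a b + turn b c = turn a c := by
  obtain ⟨u, hu⟩ := exists_re_div_pos f
  obtain ⟨ha', hu0⟩ := hu a ha
  have key : ∀ x y, 0 < f x → 0 < f y → turn x y = arg (y / u) - arg (x / u) := by
    intro x y hx hy
    rw [← arg_div_of_re_pos (hu x hx).1 (hu y hy).1, div_div_div_cancel_right₀ hu0]
    rfl
  rw [key a b ha hb, key b c hb hc, key a c ha hc]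
  ring

theorem exists_pos_of_convex {K : Set ℂ} (hK : Convex ℝ K) (hc : IsClosed K) (h0 : (0 : ℂ) ∉ K) :
    ∃ f : ℂ →ₗ[ℝ] ℝ, ∀ x ∈ K, 0 < f x := by
  obtain ⟨f, u, h1, h2⟩ := geometric_hahn_banach_point_closed hK hc h0
  refine ⟨f.toLinearMap, fun x hx => ?_⟩
  have := h2 x hx
  simp at h1
  exact h1.trans this

theorem isCompact_segment (a b : ℂ) : IsCompact (segment ℝ a b) := by
  rw [segment_eq_image_lineMap]
  exact isCompact_Icc.image AffineMap.lineMap_continuous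

theorem turn_neg_neg (a b : ℂ) : turn (-a) (-b) = turn a b := by
  simp [turn, neg_div_neg_eq]

theorem turn_add_of_zero_notMem_segment {a c : ℂ} (h : (0 : ℂ) ∉ segment ℝ a c) :
    turn a (a + c) + turn (a + c) c = turn a c := by
  obtain ⟨f, hf⟩ := exists_pos_of_convex (convex_segment a c) (isCompact_segment a c).isClosed h
  have ha := hf a (left_mem_segment ℝ a c)
  have hc := hf c (right_mem_segment ℝ a c)
  exact turn_add_of_pos f ha (by rw [map_add]; positivity) hc

theorem coe_turn_add {a b c : ℂ} (ha : a ≠ 0) (hb : b ≠ 0) (hc : c ≠ 0) :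
    ((turn a b : ℝ) : Real.Angle) + (turn b c : ℝ) = (turn a c : ℝ) := by
  unfold turn
  rw [← arg_mul_coe_angle (div_ne_zero hb ha) (div_ne_zero hc hb)]
  congr 2
  field_simp

theorem coe_sum_turn (u : ℕ → ℂ) (N : ℕ) (hu : ∀ j ≤ N, u j ≠ 0) :
    ((∑ j ∈ Finset.range N, turn (u j) (u (j + 1)) : ℝ) : Real.Angle) = (turn (u 0) (u N) : ℝ) := by
  induction N with
  | zero => simp [turn, div_self (hu 0 le_rfl)]
  | succ N ih =>
    rw [Finset.sum_range_succ, Real.Angle.coe_add, ih fun j hj => hu j (by omega)]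
    exact coe_turn_add (hu _ (by omega)) (hu _ (by omega)) (hu _ le_rfl)

theorem sum_turn_of_pos (f : ℂ →ₗ[ℝ] ℝ) (u : ℕ → ℂ) (N : ℕ) (hu : ∀ j ≤ N, 0 < f (u j)) :
    ∑ j ∈ Finset.range N, turn (u j) (u (j + 1)) = turn (u 0) (u N) := by
  induction N with
  | zero =>
    have : u 0 ≠ 0 := by intro h; have := hu 0 le_rfl; simp [h] at this
    simp [turn, div_self this]
  | succ N ih =>
    rw [Finset.sum_range_succ, ih fun j hj => hu j (by omega)]
    exact turn_add_of_pos f (hu _ (by omega)) (hu _ (by omega)) (hu _ le_rfl)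

/-- A nonpositive real quotient `r` would exhibit `x` as the convex combination of `a` and `b` with
weights `-r / (1 - r)` and `1 / (1 - r)`. So the angle under which a segment is seen is continuous
off the segment. -/
theorem div_mem_slitPlane {a b x : ℂ} (h : x ∉ segment ℝ a b) : (b - x) / (a - x) ∈ slitPlane := by
  rw [mem_slitPlane_iff_not_le_zero]
  intro hle
  have hax : a - x ≠ 0 := by
    intro h0; rw [sub_eq_zero] at h0; exact h (h0 ▸ left_mem_segment ℝ a b)
  obtain ⟨r, hr⟩ : ∃ r : ℝ, (r : ℂ) = (b - x) / (a - x) :=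
    ⟨((b - x) / (a - x)).re, by
      rw [Complex.le_def] at hle
      apply Complex.ext <;> simp [hle.2]⟩
  have hr0 : r ≤ 0 := by
    rw [← hr] at hle
    exact_mod_cast hle
  apply h
  rw [eq_div_iff hax] at hr
  have h1 : (0 : ℝ) < 1 - r := by linarith
  refine ⟨-r / (1 - r), 1 / (1 - r), by apply div_nonneg <;> linarith, by positivity,
    by rw [← add_div, div_eq_one_iff_eq h1.ne']; ring, ?_⟩
  have h2 : (1 - r : ℂ) ≠ 0 := by exact_mod_cast h1.ne'
  simp only [real_smul]
  push_cast
  field_simp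
  linear_combination -hr

/-! ### The winding number -/

/-- The winding number, times `2π`, of the closed path `z 0, …, z n` around `x`. -/
noncomputable def winding (z : ℕ → ℂ) (n : ℕ) (x : ℂ) : ℝ :=
  ∑ j ∈ Finset.range n, turn (z j - x) (z (j + 1) - x)

/-- The union of the edges of the path `z 0, …, z n`. -/
def trace (z : ℕ → ℂ) (n : ℕ) : Set ℂ := ⋃ j ∈ Set.Iio n, segment ℝ (z j) (z (j + 1))

theorem mem_trace {z : ℕ → ℂ} {n : ℕ} {x : ℂ} :
    x ∈ trace z n ↔ ∃ j < n, x ∈ segment ℝ (z j) (z (j + 1)) := by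
  simp [trace]

theorem continuousAt_turn_sub {a b x : ℂ} (h : x ∉ segment ℝ a b) :
    ContinuousAt (fun y => turn (a - y) (b - y)) x := by
  have hax : a - x ≠ 0 := by
    intro h0; rw [sub_eq_zero] at h0; exact h (h0 ▸ left_mem_segment ℝ a b)
  exact ContinuousAt.comp (f := fun y => (b - y) / (a - y)) (g := arg)
    (continuousAt_arg (div_mem_slitPlane h)) (by fun_prop (disch := assumption))

theorem continuousOn_winding (z : ℕ → ℂ) (n : ℕ) :
    ContinuousOn (winding z n) (trace z n)ᶜ := by
  intro x hx
  apply ContinuousAt.continuousWithinAt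
  unfold winding
  apply tendsto_finsetSum
  intro j hj
  refine continuousAt_turn_sub fun h => hx (mem_trace.2 ⟨j, Finset.mem_range.1 hj, h⟩)

theorem winding_mem {z : ℕ → ℂ} {n : ℕ} (hn : 0 < n) (hz : z n = z 0) {x : ℂ} (hx : x ∉ trace z n) :
    winding z n x ∈ Set.range fun k : ℤ => (k : ℝ) * (2 * Real.pi) := by
  have h0 : ∀ j ≤ n, z j - x ≠ 0 := by
    intro j hj h
    rw [sub_eq_zero] at h
    apply hx
    rw [mem_trace]
    rcases hj.lt_or_eq with hj | rfl
    · exact ⟨j, hj, h ▸ left_mem_segment ℝ _ _⟩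
    · exact ⟨0, hn, by rw [← h, hz]; exact left_mem_segment ℝ _ _⟩
  have h := coe_sum_turn (fun j => z j - x) n h0
  simp only [hz] at h
  rw [turn, div_self (h0 0 (Nat.zero_le _)), arg_one, Real.Angle.angle_eq_iff_two_pi_dvd_sub] at h
  obtain ⟨k, hk⟩ := h
  refine ⟨k, ?_⟩
  simp only [winding]
  linarith

/-- The winding number is continuous off the path and takes values in the discrete group `2πℤ`. -/
theorem winding_eq_of_isPreconnected {z : ℕ → ℂ} {n : ℕ} (hn : 0 < n) (hz : z n = z 0) {S : Set ℂ}
    (hS : IsPreconnected S) (hd : ∀ x ∈ S, x ∉ trace z n) {x y : ℂ} (hx : x ∈ S) (hy : y ∈ S) :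
    winding z n x = winding z n y := by
  have hT : IsDiscrete (Set.range fun k : ℤ => (k : ℝ) * (2 * Real.pi)) := by
    rw [isDiscrete_iff_discreteTopology]
    have : (Set.range fun k : ℤ => (k : ℝ) * (2 * Real.pi)) =
        (AddSubgroup.zmultiples (2 * Real.pi) : Set ℝ) := by
      ext t; simp [AddSubgroup.mem_zmultiples_iff]
    rw [this]
    exact inferInstanceAs (DiscreteTopology (AddSubgroup.zmultiples (2 * Real.pi)))
  exact hS.constant_of_mapsTo hT ((continuousOn_winding z n).mono hd)
    (fun x hx => winding_mem hn hz (hd x hx)) hx hy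

theorem exists_winding_eq_zero {z : ℕ → ℂ} {n : ℕ} (hz : z n = z 0) :
    ∃ R : ℝ, ∀ x : ℂ, R < ‖x‖ → winding z n x = 0 := by
  obtain ⟨R, hR⟩ : ∃ R : ℝ, ∀ j ≤ n, ‖z j‖ ≤ R := by
    refine ⟨∑ j ∈ Finset.range (n + 1), ‖z j‖, fun j hj => ?_⟩
    exact Finset.single_le_sum (f := fun j => ‖z j‖) (fun _ _ => norm_nonneg _)
      (Finset.mem_range.2 (by omega))
  have hR0 : 0 ≤ R := (norm_nonneg _).trans (hR 0 (Nat.zero_le _))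
  refine ⟨R, fun x hx => ?_⟩
  -- From a point `x` farther out than all vertices, the whole path is seen in the half-plane of
  -- directions making an obtuse angle with `x`, so the turns telescope.
  let f : ℂ →ₗ[ℝ] ℝ := -(reLm ∘ₗ LinearMap.mulRight ℝ ((starRingEnd ℂ) x))
  have hf : ∀ j ≤ n, 0 < f (z j - x) := by
    intro j hj
    have h1 : f (z j - x) = ‖x‖ ^ 2 - (z j * (starRingEnd ℂ) x).re := by
      have h : (x * (starRingEnd ℂ) x).re = ‖x‖ ^ 2 := by
        rw [mul_conj, ofReal_re, normSq_eq_norm_sq]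
      simp only [f, LinearMap.neg_apply, LinearMap.comp_apply, LinearMap.mulRight_apply, reLm_coe,
        sub_mul, sub_re, h]
      ring
    have h2 : (z j * (starRingEnd ℂ) x).re ≤ R * ‖x‖ := by
      refine (re_le_norm _).trans ?_
      rw [norm_mul, RCLike.norm_conj]
      gcongr
      exact hR j hj
    rw [h1]
    nlinarith
  rw [winding, sum_turn_of_pos f (fun j => z j - x) n hf]
  have : z 0 - x ≠ 0 := by intro h; have := hf 0 (Nat.zero_le _); simp [h] at this
  simp [hz, turn, div_self this]

theorem isBounded_of_winding_ne_zero {z : ℕ → ℂ} {n : ℕ} (hn : 0 < n) (hz : z n = z 0) {x : ℂ}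
    (hx : x ∉ trace z n) (hw : winding z n x ≠ 0) :
    Bornology.IsBounded (connectedComponentIn (trace z n)ᶜ x) := by
  obtain ⟨R, hR⟩ := exists_winding_eq_zero hz
  refine (Metric.isBounded_closedBall (x := (0 : ℂ)) (r := R)).subset fun y hy => ?_
  by_contra hlt
  rw [mem_closedBall_zero_iff, not_le] at hlt
  apply hw
  rw [← hR y hlt]
  exact winding_eq_of_isPreconnected hn hz isPreconnected_connectedComponentIn
    (fun y hy => connectedComponentIn_subset _ _ hy) (mem_connectedComponentIn hx) hy

theorem winding_eq_zero_of_ray {z : ℕ → ℂ} {n : ℕ} (hn : 0 < n) (hz : z n = z 0) {x d : ℂ}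
    (hd : d ≠ 0) (h : ∀ t : ℝ, 0 ≤ t → x + t * d ∉ trace z n) : winding z n x = 0 := by
  obtain ⟨R, hR⟩ := exists_winding_eq_zero hz
  have hS : IsPreconnected ((fun t : ℝ => x + t * d) '' Set.Ici 0) :=
    isPreconnected_Ici.image _ (by fun_prop)
  have hd' : 0 < ‖d‖ := norm_pos_iff.2 hd
  obtain ⟨t, ht0, ht⟩ : ∃ t : ℝ, 0 ≤ t ∧ R < ‖x + t * d‖ := by
    refine ⟨(|R| + ‖x‖ + 1) / ‖d‖, by positivity, ?_⟩
    have h1 : ‖(((|R| + ‖x‖ + 1) / ‖d‖ : ℝ) : ℂ) * d‖ = |R| + ‖x‖ + 1 := by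
      rw [norm_mul, norm_real, Real.norm_of_nonneg (by positivity)]
      field_simp
    have h2 := norm_sub_le (x + (((|R| + ‖x‖ + 1) / ‖d‖ : ℝ) : ℂ) * d) x
    rw [add_sub_cancel_left, h1] at h2
    linarith [le_abs_self R]
  rw [← hR _ ht]
  refine winding_eq_of_isPreconnected hn hz hS ?_ ⟨0, Set.self_mem_Ici, by simp⟩ ⟨t, ht0, rfl⟩
  rintro _ ⟨t, ht, rfl⟩
  exact h t ht

/-! ### Total turning of a simple closed path as a sweep from one vertex -/

open scoped Pointwise

/-- The `n`-periodic sequence `z` runs through the vertices of a simple closed polygon. -/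
structure IsSimpleClosed (z : ℕ → ℂ) (n : ℕ) : Prop where
  three_le : 3 ≤ n
  periodic : ∀ j, z (j + n) = z j
  ne : ∀ j, z j ≠ z (j + 1)
  consecutive : ∀ j x, x ∈ segment ℝ (z j) (z (j + 1)) →
    x ∈ segment ℝ (z (j + 1)) (z (j + 2)) → x = z (j + 1)
  nonconsecutive : ∀ i j, i + 1 < j → j + 1 < i + n →
    Disjoint (segment ℝ (z i) (z (i + 1))) (segment ℝ (z j) (z (j + 1)))

/-- The turning angle from the edge `j` to the edge `j + 1`. -/
noncomputable def exteriorAngle (z : ℕ → ℂ) (j : ℕ) : ℝ :=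
  turn (z (j + 1) - z j) (z (j + 2) - z (j + 1))

theorem sum_range_shift_of_periodic {F : ℕ → ℝ} {n : ℕ} (hF : ∀ j, F (j + n) = F j) (k : ℕ) :
    ∑ i ∈ Finset.range n, F (k + i) = ∑ i ∈ Finset.range n, F i := by
  induction k with
  | zero => simp
  | succ k ih =>
    rw [← ih]
    have h1 := Finset.sum_range_succ (fun i => F (k + i)) n
    have h2 := Finset.sum_range_succ' (fun i => F (k + i)) n
    rw [hF] at h1
    simp only [add_zero] at h2
    simp only [show ∀ i, k + 1 + i = k + (i + 1) by intro i; ring]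
    linarith

namespace IsSimpleClosed

variable {z : ℕ → ℂ} {n : ℕ}

theorem shift (h : IsSimpleClosed z n) (k : ℕ) : IsSimpleClosed (fun j => z (k + j)) n where
  three_le := h.three_le
  periodic j := by rw [← add_assoc]; exact h.periodic (k + j)
  ne j := h.ne (k + j)
  consecutive j := h.consecutive (k + j)
  nonconsecutive i j hi hj := h.nonconsecutive (k + i) (k + j) (by omega) (by omega)

theorem vertex_ne (h : IsSimpleClosed z n) {i j : ℕ} (hij : i < j) (hj : j < i + n) :
    z i ≠ z j := by
  intro he
  rcases Nat.lt_or_ge (i + 1) j with h1 | h1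
  · rcases Nat.lt_or_ge (j + 1) (i + n) with h2 | h2
    · exact Set.disjoint_left.1 (h.nonconsecutive i j h1 h2) (left_mem_segment ℝ _ _)
        (he ▸ left_mem_segment ℝ _ _)
    · have : j + 1 = i + n := by omega
      apply h.ne j
      rw [this, h.periodic, he]
  · have : j = i + 1 := by omega
    exact h.ne i (this ▸ he)

theorem zero_notMem_segment_edges (h : IsSimpleClosed z n) (j : ℕ) :
    (0 : ℂ) ∉ segment ℝ (z (j + 1) - z j) (z (j + 2) - z (j + 1)) := by
  rintro ⟨s, t, hs, ht, hst, h0⟩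
  simp only [real_smul] at h0
  -- If the two edge vectors balance with weights `s` and `t`, going back by the fraction `s` of the
  -- first edge equals going on by the fraction `t` of the second. This point lies on both edges, so
  -- it is the common vertex.
  have hx : z (j + 1) - s * (z (j + 1) - z j) = z (j + 1) := by
    apply h.consecutive j
    · exact ⟨s, t, hs, ht, hst, by
        simp only [real_smul]
        have : (t : ℂ) = 1 - s := by
          have := congrArg ((↑) : ℝ → ℂ) hst
          push_cast at this; linear_combination this
        rw [this]; ring⟩
    · exact ⟨s, t, hs, ht, hst, by
        simp only [real_smul]
        have : (s : ℂ) = 1 - t := by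
          have := congrArg ((↑) : ℝ → ℂ) hst
          push_cast at this; linear_combination this
        rw [this] at h0 ⊢; linear_combination h0⟩
  have hs0 : s = 0 := by
    have := sub_ne_zero.2 (h.ne j).symm
    simpa [this] using hx
  have ht1 : t = 1 := by linarith
  rw [hs0, ht1] at h0
  exact sub_ne_zero.2 (h.ne (j + 1)).symm (by simpa using h0)

/-- The homotopy step over a pair of disjoint edges. -/
theorem turn_square (h : IsSimpleClosed z n) {i j : ℕ} (hij : i + 1 < j) (hj : j + 1 < i + n) :
    turn (z j - z i) (z (j + 1) - z i) + turn (z (j + 1) - z i) (z (j + 1) - z (i + 1)) =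
      turn (z j - z i) (z j - z (i + 1)) + turn (z j - z (i + 1)) (z (j + 1) - z (i + 1)) := by
  have hc : IsClosed (segment ℝ (z j) (z (j + 1)) - segment ℝ (z i) (z (i + 1))) :=
    by
    rw [sub_eq_add_neg]
    exact ((isCompact_segment _ _).add (isCompact_segment _ _).neg).isClosed
  obtain ⟨f, hf⟩ := exists_pos_of_convex
    ((convex_segment (z j) (z (j + 1))).sub (convex_segment (z i) (z (i + 1)))) hc (by
      rw [Set.zero_mem_sub_iff]
      exact fun hn => hn (h.nonconsecutive i j hij hj).symm)
  have h1 := hf _ (Set.sub_mem_sub (left_mem_segment ℝ (z j) (z (j + 1)))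
    (left_mem_segment ℝ (z i) (z (i + 1))))
  have h2 := hf _ (Set.sub_mem_sub (left_mem_segment ℝ (z j) (z (j + 1)))
    (right_mem_segment ℝ (z i) (z (i + 1))))
  have h3 := hf _ (Set.sub_mem_sub (right_mem_segment ℝ (z j) (z (j + 1)))
    (left_mem_segment ℝ (z i) (z (i + 1))))
  have h4 := hf _ (Set.sub_mem_sub (right_mem_segment ℝ (z j) (z (j + 1)))
    (right_mem_segment ℝ (z i) (z (i + 1))))
  rw [turn_add_of_pos f h1 h3 h4, turn_add_of_pos f h1 h2 h4]

theorem turn_triangle (h : IsSimpleClosed z n) (i : ℕ) :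
    turn (z (i + 1) - z i) (z (i + 2) - z i) + turn (z (i + 2) - z i) (z (i + 2) - z (i + 1)) =
      exteriorAngle z i := by
  have := turn_add_of_zero_notMem_segment (h.zero_notMem_segment_edges i)
  rwa [show z (i + 1) - z i + (z (i + 2) - z (i + 1)) = z (i + 2) - z i by ring] at this

/-- Discrete form of Hopf's homotopy: consider the directions `z j - z i` over the grid of pairs `i
< j`. The total turn along a grid path is unchanged by pushing it across a square, and the triangle
at the diagonal contributes an exterior angle. Here the view from `z i` is exchanged for the view
from `z (i + 1)`. -/
theorem row_step (h : IsSimpleClosed z n) (i k : ℕ) (hk : i + 2 + k < i + n) :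
    ∑ j ∈ Finset.range (k + 1), turn (z (i + 1 + j) - z i) (z (i + 1 + (j + 1)) - z i) +
        turn (z (i + 2 + k) - z i) (z (i + 2 + k) - z (i + 1)) =
      exteriorAngle z i +
        ∑ j ∈ Finset.range k,
          turn (z (i + 2 + j) - z (i + 1)) (z (i + 2 + (j + 1)) - z (i + 1)) := by
  induction k with
  | zero => simpa using h.turn_triangle i
  | succ k ih =>
    have ih := ih (by omega)
    have hs := h.turn_square (i := i) (j := i + 2 + k) (by omega) (by omega)
    rw [Finset.sum_range_succ _ (k + 1), Finset.sum_range_succ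
      (fun j => turn (z (i + 2 + j) - z (i + 1)) (z (i + 2 + (j + 1)) - z (i + 1))) k]
    rw [show i + 1 + (k + 1) = i + 2 + k by ring, show i + 1 + (k + 1 + 1) = i + 2 + k + 1 by ring,
      show i + 2 + (k + 1) = i + 2 + k + 1 by ring]
    linarith

/-- The angle swept out by the view from the vertex `k` along the edges not incident to it. -/
noncomputable def _root_.PlanePath.sweep (z : ℕ → ℂ) (n k : ℕ) : ℝ :=
  ∑ j ∈ Finset.range (n - 2), turn (z (k + 1 + j) - z k) (z (k + 1 + (j + 1)) - z k)

/-- The total turning in terms of the view from the vertex `0`. -/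
theorem total_turning_eq_sweep (h : IsSimpleClosed z n) :
    ∑ i ∈ Finset.range n, exteriorAngle z i = 2 * (sweep z n 0 + exteriorAngle z (n - 1)) := by
  obtain ⟨m, rfl⟩ : ∃ m, n = m + 3 := ⟨n - 3, by have := h.three_le; omega⟩
  have hper : z (m + 3) = z 0 := by simpa using h.periodic 0
  have hper1 : z (m + 4) = z 1 := by rw [show m + 4 = 1 + (m + 3) by ring]; exact h.periodic 1
  -- rows `1, …, m + 2`, each up to the column `m + 3`
  have hrows : ∀ r ≤ m + 1,
      ∑ j ∈ Finset.range (m + 1), turn (z (2 + j) - z 1) (z (2 + (j + 1)) - z 1) +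
        ∑ i ∈ Finset.range r, turn (z (1 + i) - z 0) (z (1 + (i + 1)) - z 0) =
      ∑ i ∈ Finset.range r, exteriorAngle z (i + 1) +
        ∑ j ∈ Finset.range (m + 1 - r),
          turn (z (r + 2 + j) - z (r + 1)) (z (r + 2 + (j + 1)) - z (r + 1)) := by
    intro r hr
    induction r with
    | zero => simp
    | succ r ih =>
      have ih := ih (by omega)
      have hs := h.row_step (r + 1) (m - r) (by omega)
      rw [Finset.sum_range_succ _ r, ← add_assoc, ih, Finset.sum_range_succ _ r,
        show m + 1 - r = m - r + 1 by omega, show m + 1 - (r + 1) = m - r by omega]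
      rw [show r + 1 + 2 + (m - r) = m + 3 by omega, hper, show r + 1 + 1 = r + 2 by ring] at hs
      rw [show 1 + r = r + 1 by ring, show 1 + (r + 1) = r + 2 by ring, show r + 1 + 1 = r + 2 by ring,
        ← turn_neg_neg, neg_sub, neg_sub]
      linarith
  have h1 := hrows (m + 1) le_rfl
  have h0 := h.row_step 0 m (by omega)
  -- The grid corner `(0, n)` is degenerate because `z n = z 0`. The homotopy cuts it off through
  -- `(0, n - 1)`, `(1, n - 1)`, `(1, n)`, and that detour turns by the exterior angle at `z 0`. The
  -- column `n` is the row `0` with directions negated, so the sweep occurs twice.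
  have hc := turn_add_of_zero_notMem_segment (h.zero_notMem_segment_edges (m + 2))
  simp only [show m + 2 + 1 = m + 3 by ring, show m + 2 + 2 = m + 4 by ring, hper, hper1] at hc
  rw [show z 0 - z (m + 2) + (z 1 - z 0) = z 1 - z (m + 2) by ring, ← turn_neg_neg, neg_sub, neg_sub,
    ← turn_neg_neg (z 1 - z (m + 2)), neg_sub, neg_sub] at hc
  have hlast : exteriorAngle z (m + 2) = turn (z 0 - z (m + 2)) (z 1 - z 0) := by
    rw [exteriorAngle, show m + 2 + 1 = m + 3 by ring, show m + 2 + 2 = m + 4 by ring, hper, hper1]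
  rw [show m + 3 - 1 = m + 2 by omega, sweep, show m + 3 - 2 = m + 1 by omega, Finset.sum_range_succ',
    Finset.sum_range_succ, hlast]
  rw [Finset.sum_range_succ, show 2 + m = m + 2 by ring, show 2 + (m + 1) = m + 3 by ring, hper] at h1
  simp only [Nat.sub_self, Finset.range_zero, Finset.sum_empty, add_zero, zero_add,
    show 2 + m = m + 2 by ring] at h0 h1 ⊢
  linarith

theorem exteriorAngle_periodic (h : IsSimpleClosed z n) (j : ℕ) :
    exteriorAngle z (j + n) = exteriorAngle z j := by
  have h1 := h.periodic (j + 1)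
  have h2 := h.periodic (j + 2)
  rw [exteriorAngle, exteriorAngle, show j + n + 1 = j + 1 + n by ring,
    show j + n + 2 = j + 2 + n by ring, h1, h2, h.periodic]

theorem sum_exteriorAngle_shift (h : IsSimpleClosed z n) (k : ℕ) :
    ∑ i ∈ Finset.range n, exteriorAngle z (k + i) = ∑ i ∈ Finset.range n, exteriorAngle z i :=
  sum_range_shift_of_periodic h.exteriorAngle_periodic k

end IsSimpleClosed

/-! ### The theorem of turning tangents, and the inside at a convex corner -/

/-- The oriented area of the parallelogram spanned by `x` and `y`. -/
def cross (x y : ℂ) : ℝ := x.re * y.im - x.im * y.re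

theorem im_div_eq (x y : ℂ) : (y / x).im = cross x y / normSq x := by
  rw [div_im, cross]; ring

theorem normSq_pos_of_cross_ne {x y : ℂ} (h : cross x y ≠ 0) : 0 < normSq x := by
  apply normSq_pos.2
  rintro rfl
  simp [cross] at h

theorem div_mem_slitPlane_of_cross_ne {x y : ℂ} (h : cross x y ≠ 0) : y / x ∈ slitPlane := by
  right
  rw [im_div_eq]
  exact div_ne_zero h (normSq_pos_of_cross_ne h).ne'

theorem mul_turn_pos {σ : ℝ} (hσ : σ = 1 ∨ σ = -1) {x y : ℂ} (h : 0 < σ * cross x y) :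
    0 < σ * turn x y := by
  have hn : 0 < normSq x := normSq_pos_of_cross_ne (right_ne_zero_of_mul h.ne')
  unfold turn
  rcases hσ with rfl | rfl
  · rw [one_mul] at h ⊢
    have him : 0 < (y / x).im := by rw [im_div_eq]; positivity
    apply lt_of_le_of_ne (arg_nonneg_iff.2 him.le)
    intro h0
    exact him.ne' (arg_eq_zero_iff.1 h0.symm).2
  · have him : (y / x).im < 0 := by
      rw [im_div_eq]; apply div_neg_of_neg_of_pos _ hn; linarith
    linarith [arg_neg_iff.2 him]

theorem mul_turn_nonpos {σ : ℝ} (hσ : σ = 1 ∨ σ = -1) {x y : ℂ} (h : σ * cross x y ≤ 0)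
    (hne : turn x y ≠ Real.pi) : σ * turn x y ≤ 0 := by
  unfold turn at *
  rcases hσ with rfl | rfl
  · rw [one_mul] at h ⊢
    have him : (y / x).im ≤ 0 := by
      rw [im_div_eq]; exact div_nonpos_of_nonpos_of_nonneg h (normSq_nonneg _)
    rcases him.lt_or_eq with him | him
    · exact (arg_neg_iff.2 him).le
    · rcases lt_or_ge (y / x).re 0 with hre | hre
      · exact absurd (arg_eq_pi_iff.2 ⟨hre, him⟩) hne
      · exact (arg_eq_zero_iff.2 ⟨hre, him⟩).le
  · have him : 0 ≤ (y / x).im := by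
      rw [im_div_eq]; exact div_nonneg (by linarith) (normSq_nonneg _)
    linarith [arg_nonneg_iff.2 him]

theorem turn_ne_pi_of_zero_notMem_segment {a c : ℂ} (h : (0 : ℂ) ∉ segment ℝ a c) :
    turn a c ≠ Real.pi := by
  have := div_mem_slitPlane h
  rw [sub_zero, sub_zero] at this
  exact slitPlane_arg_ne_pi this

theorem turn_real_mul_left {t : ℝ} (ht : 0 < t) (a b : ℂ) : turn (t * a) b = turn a b := by
  unfold turn
  rw [show b / (t * a) = (t⁻¹ : ℝ) * (b / a) by
    have : (t : ℂ) ≠ 0 := by exact_mod_cast ht.ne'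
    push_cast
    rcases eq_or_ne a 0 with rfl | ha
    · simp
    · field_simp]
  exact arg_real_mul _ (inv_pos.2 ht)

theorem turn_real_mul_right {t : ℝ} (ht : 0 < t) (a b : ℂ) : turn a (t * b) = turn a b := by
  unfold turn
  rw [mul_div_assoc]
  exact arg_real_mul _ ht

theorem exists_of_mem_segment {a b x : ℂ} (h : x ∈ segment ℝ a b) :
    ∃ t : ℝ, 0 ≤ t ∧ t ≤ 1 ∧ x = a + t * (b - a) := by
  rw [segment_eq_image'] at h
  obtain ⟨t, ht, rfl⟩ := h
  exact ⟨t, ht.1, ht.2, by simp⟩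

theorem mem_segment_of {a b : ℂ} {t : ℝ} (h0 : 0 ≤ t) (h1 : t ≤ 1) :
    a + t * (b - a) ∈ segment ℝ a b := by
  rw [segment_eq_image']
  exact ⟨t, ⟨h0, h1⟩, by simp⟩

namespace IsSimpleClosed

variable {z : ℕ → ℂ} {n : ℕ}

theorem abs_exteriorAngle_lt (h : IsSimpleClosed z n) (j : ℕ) : |exteriorAngle z j| < Real.pi := by
  rw [abs_lt]
  exact ⟨neg_pi_lt_arg _, lt_of_le_of_ne (arg_le_pi _)
    (turn_ne_pi_of_zero_notMem_segment (h.zero_notMem_segment_edges j))⟩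

theorem mod_eq (h : IsSimpleClosed z n) (j : ℕ) : z (j % n) = z j :=
  Function.Periodic.map_mod_nat h.periodic j

theorem segment_subset_trace (h : IsSimpleClosed z n) (j : ℕ) :
    segment ℝ (z j) (z (j + 1)) ⊆ trace z n := by
  intro x hx
  refine mem_trace.2 ⟨j % n, Nat.mod_lt _ (by have := h.three_le; omega), ?_⟩
  rw [h.mod_eq, ← h.mod_eq (j % n + 1), Nat.mod_add_mod, h.mod_eq]
  exact hx

theorem trace_shift (h : IsSimpleClosed z n) (k : ℕ) :
    trace (fun j => z (k + j)) n = trace z n := by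
  ext x
  constructor
  · intro hx
    obtain ⟨j, -, hx⟩ := mem_trace.1 hx
    exact h.segment_subset_trace (k + j) hx
  · intro hx
    obtain ⟨j, -, hx⟩ := mem_trace.1 hx
    obtain ⟨c, hc⟩ : ∃ c, k + c = j + k * n :=
      ⟨j + k * (n - 1), by
        obtain ⟨m, rfl⟩ : ∃ m, n = m + 1 := ⟨n - 1, by have := h.three_le; omega⟩
        rw [Nat.add_sub_cancel]; ring⟩
    have h1 : z (j + k * n) = z j := by
      rw [← h.mod_eq (j + k * n), Nat.add_mul_mod_self_right, h.mod_eq]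
    have h2 : z (j + k * n + 1) = z (j + 1) := by
      rw [← h.mod_eq, show j + k * n + 1 = j + 1 + k * n by ring, Nat.add_mul_mod_self_right, h.mod_eq]
    apply (h.shift k).segment_subset_trace c
    simp only [← add_assoc, hc, h1, h2]
    exact hx

theorem winding_shift (h : IsSimpleClosed z n) (k : ℕ) (x : ℂ) :
    winding (fun j => z (k + j)) n x = winding z n x := by
  apply sum_range_shift_of_periodic (F := fun j => turn (z j - x) (z (j + 1) - x))
  intro j
  simp only [h.periodic, show j + n + 1 = j + 1 + n by ring]

/-- Seen from a vertex with all the others in an open half-plane, the sweep telescopes to the angle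
between the two edges there. Together with the exterior angle it makes up a straight angle, with
sign according to orientation. -/
theorem total_turning_eq_of_pos (h : IsSimpleClosed z n) (F : ℂ →ₗ[ℝ] ℝ)
    (hF : ∀ j, 0 < j → j < n → 0 < F (z j - z 0)) :
    ∃ σ : ℝ, (σ = 1 ∨ σ = -1) ∧ ∑ i ∈ Finset.range n, exteriorAngle z i = 2 * Real.pi * σ := by
  have h3 := h.three_le
  have hs : sweep z n 0 = turn (z 1 - z 0) (z (n - 1) - z 0) := by
    have := sum_turn_of_pos F (fun j => z (0 + 1 + j) - z 0) (n - 2)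
      (fun j hj => hF _ (by omega) (by omega))
    rw [show 0 + 1 + (n - 2) = n - 1 by omega] at this
    exact this
  have hT := h.total_turning_eq_sweep
  have hf := hF 1 (by omega) (by omega)
  have hg := hF (n - 1) (by omega) (by omega)
  have h0 := h.zero_notMem_segment_edges (n - 1)
  have hper : z n = z 0 := by simpa using h.periodic 0
  have hper1 : z (n + 1) = z 1 := by rw [add_comm]; exact h.periodic 1
  rw [show n - 1 + 1 = n by omega, show n - 1 + 2 = n + 1 by omega, hper, hper1] at h0
  rw [hs, exteriorAngle, show n - 1 + 1 = n by omega, show n - 1 + 2 = n + 1 by omega, hper,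
    hper1] at hT
  rw [show z 0 - z (n - 1) = -(z (n - 1) - z 0) by ring] at hT h0
  generalize z 1 - z 0 = f at *
  generalize z (n - 1) - z 0 = g at *
  have hg0 : g ≠ 0 := by rintro rfl; simp at hg
  have hslit := div_mem_slitPlane h0
  rw [sub_zero, sub_zero, div_neg] at hslit
  have him : (f / g).im ≠ 0 := by
    intro him
    have hfg : f = (f / g).re * g := by
      have : (((f / g).re : ℝ) : ℂ) = f / g := by apply Complex.ext <;> simp [him]
      rw [this, div_mul_cancel₀ _ hg0]
    have hre : 0 < (f / g).re := by
      rw [hfg, ← real_smul, map_smul, smul_eq_mul] at hf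
      exact pos_of_mul_pos_left hf hg.le
    rcases hslit with h1 | h1
    · rw [neg_re] at h1; linarith
    · rw [neg_im] at h1; exact h1 (by rw [him, neg_zero])
  have hne : arg (f / g) ≠ Real.pi := fun hp => him (arg_eq_pi_iff.1 hp).2
  have h1 : turn f g = -arg (f / g) := by
    rw [turn, ← inv_div, arg_inv, if_neg hne]
  rw [h1, turn, div_neg] at hT
  rcases lt_or_gt_of_ne him with him | him
  · exact ⟨1, Or.inl rfl, by rw [hT, arg_neg_eq_arg_add_pi_of_im_neg him]; ring⟩
  · exact ⟨-1, Or.inr rfl, by rw [hT, arg_neg_eq_arg_sub_pi_of_im_pos him]; ring⟩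

/-- The theorem of turning tangents for polygons. -/
theorem exists_total_turning_eq (h : IsSimpleClosed z n) :
    ∃ σ : ℝ, (σ = 1 ∨ σ = -1) ∧ ∑ i ∈ Finset.range n, exteriorAngle z i = 2 * Real.pi * σ := by
  have h3 := h.three_le
  obtain ⟨k, -, hk⟩ := Finset.exists_max_image (Finset.range n) (fun j => ‖z j‖)
    ⟨0, Finset.mem_range.2 (by omega)⟩
  have hk' : ∀ j, ‖z j‖ ≤ ‖z k‖ := fun j => by
    rw [← h.mod_eq]; exact hk _ (Finset.mem_range.2 (Nat.mod_lt _ (by omega)))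
  -- The vertex farthest from the origin is an extreme point: the line through it perpendicular to
  -- its radius vector has all other vertices strictly on the origin's side.
  obtain ⟨σ, hσ, hT⟩ := (h.shift k).total_turning_eq_of_pos
    (-(reLm ∘ₗ LinearMap.mulRight ℝ ((starRingEnd ℂ) (z k)))) (by
      intro j hj hjn
      have hne : z k ≠ z (k + j) := h.vertex_ne (by omega) (by omega)
      have hle := hk' (k + j)
      have hle2 := sq_le_sq' (by linarith [norm_nonneg (z k), norm_nonneg (z (k + j))]) hle
      have hsub := norm_pos_iff.2 (sub_ne_zero.2 hne)
      have hsq : 0 < ‖z k - z (k + j)‖ ^ 2 := by positivity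
      rw [← normSq_eq_norm_sq, normSq_apply] at hsq
      rw [← normSq_eq_norm_sq, ← normSq_eq_norm_sq, normSq_apply, normSq_apply] at hle2
      simp only [LinearMap.neg_apply, LinearMap.comp_apply, LinearMap.mulRight_apply, reLm_coe,
        mul_re, conj_re, conj_im, add_zero, sub_re, sub_im] at hsq ⊢
      nlinarith)
  refine ⟨σ, hσ, ?_⟩
  rw [← hT, ← h.sum_exteriorAngle_shift k]
  rfl

/-- As the point tends to the vertex along `b = f + g`, its winding number tends to the turn from
`-b` to `f`, plus the sweep, plus the turn from `g` to `-b`. All three have the sign `σ`; for the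
sweep this holds because it is `πσ` minus an exterior angle smaller than `π` in absolute value. -/
theorem eventually_winding_ne_zero_zero (h : IsSimpleClosed z n) {σ : ℝ} (hσ : σ = 1 ∨ σ = -1)
    (hT : ∑ i ∈ Finset.range n, exteriorAngle z i = 2 * Real.pi * σ)
    (hc : 0 < σ * cross (z 1 - z 0) (z (n - 1) - z 0)) :
    ∀ᶠ t : ℝ in 𝓝[>] 0, z 0 + t * ((z 1 - z 0) + (z (n - 1) - z 0)) ∉ trace z n ∧
      winding z n (z 0 + t * ((z 1 - z 0) + (z (n - 1) - z 0))) ≠ 0 := by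
  have h3 := h.three_le
  have hper : z n = z 0 := by simpa using h.periodic 0
  have hsw : 0 < σ * sweep z n 0 := by
    have h1 := h.total_turning_eq_sweep
    have h2 := abs_lt.1 (h.abs_exteriorAngle_lt (n - 1))
    rw [hT] at h1
    rcases hσ with rfl | rfl <;> linarith [Real.pi_pos]
  have hmid : ∀ j < n - 2, z 0 ∉ segment ℝ (z (0 + 1 + j)) (z (0 + 1 + (j + 1))) := by
    intro j hj hmem
    rcases Nat.eq_zero_or_pos j with rfl | hj0
    · exact h.ne 0 (h.consecutive 0 _ (left_mem_segment ℝ _ _) (by simpa using hmem))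
    · exact Set.disjoint_left.1 (h.nonconsecutive 0 (0 + 1 + j) (by omega) (by omega))
        (left_mem_segment ℝ _ _) hmem
  set f := z 1 - z 0 with hf
  set g := z (n - 1) - z 0 with hg
  set b := f + g with hb
  have hlim : Filter.Tendsto (fun t : ℝ => z 0 + t * b) (𝓝 0) (𝓝 (z 0)) := by
    have : ContinuousAt (fun t : ℝ => z 0 + t * b) 0 := by fun_prop
    simpa [ContinuousAt] using this
  have hc1 : 0 < σ * cross (-b) f := by
    convert hc using 2; simp [cross, hb]; ring
  have hc2 : 0 < σ * cross g (-b) := by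
    convert hc using 2; simp [cross, hb]; ring
  have hcfg : cross f g ≠ 0 := right_ne_zero_of_mul hc.ne'
  -- the limit of the winding number along the bisector
  have hW : ∀ᶠ t : ℝ in 𝓝[>] 0, winding z n (z 0 + t * b) ≠ 0 := by
    -- The two terms at the vertex involve `z 0 - x = -(t * b)`, which degenerates at `t = 0`. Turns
    -- ignore positive scaling, so `-b` can replace it, and `G` is continuous at `0`.
    let G : ℝ → ℝ := fun t => turn (-b) (f - t * b) +
      (∑ j ∈ Finset.range (n - 2),
        turn (z (0 + 1 + j) - (z 0 + t * b)) (z (0 + 1 + (j + 1)) - (z 0 + t * b))) +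
      turn (g - t * b) (-b)
    have hG : ContinuousAt G 0 := by
      refine ContinuousAt.add (ContinuousAt.add ?_ ?_) ?_
      · refine ContinuousAt.comp (f := fun t : ℝ => (f - t * b) / (-b)) (g := arg)
          (continuousAt_arg ?_) (by fun_prop)
        simpa using div_mem_slitPlane_of_cross_ne (right_ne_zero_of_mul hc1.ne')
      · apply tendsto_finsetSum
        intro j hj
        have := (continuousAt_turn_sub (hmid j (Finset.mem_range.1 hj))).tendsto.comp hlim
        simpa [Function.comp_def] using this
      · have hg0 : g ≠ 0 := by rintro h0; simp [h0, cross] at hcfg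
        refine ContinuousAt.comp (f := fun t : ℝ => (-b) / (g - t * b)) (g := arg)
          (continuousAt_arg ?_) (ContinuousAt.div (by fun_prop) (by fun_prop) (by simpa using hg0))
        simpa using div_mem_slitPlane_of_cross_ne (right_ne_zero_of_mul hc2.ne')
    have hG0 : G 0 ≠ 0 := by
      have h1 := mul_turn_pos hσ hc1
      have h2 := mul_turn_pos hσ hc2
      have h4 : G 0 = turn (-b) f + sweep z n 0 + turn g (-b) := by simp [G, sweep]
      apply right_ne_zero_of_mul (a := σ)
      rw [h4, mul_add, mul_add]
      positivity
    have hev := (hG.eventually_ne hG0).filter_mono (nhdsWithin_le_nhds (s := Set.Ioi 0))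
    filter_upwards [hev, self_mem_nhdsWithin] with t ht ht0
    have ht0 : 0 < t := ht0
    convert ht using 1
    obtain ⟨m, rfl⟩ : ∃ m, n = m + 2 := ⟨n - 2, by omega⟩
    rw [winding, Finset.sum_range_succ, Finset.sum_range_succ']
    simp only [G, hper, Nat.add_sub_cancel, zero_add, add_comm 1]
    rw [show z 0 - (z 0 + t * b) = t * (-b) by ring, turn_real_mul_left ht0,
      turn_real_mul_right ht0, show z 1 - (z 0 + t * b) = f - t * b by rw [hf]; ring,
      show z (m + 1) - (z 0 + t * b) = g - t * b by rw [hg]; simp; ring]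
    ring
  have htr : ∀ᶠ t : ℝ in 𝓝[>] 0, ∀ j ∈ Finset.range (n - 2),
      z 0 + t * b ∉ segment ℝ (z (0 + 1 + j)) (z (0 + 1 + (j + 1))) := by
    rw [Finset.eventually_all]
    intro j hj
    exact (hlim.eventually ((isCompact_segment _ _).isClosed.isOpen_compl.mem_nhds
      (hmid j (Finset.mem_range.1 hj)))).filter_mono nhdsWithin_le_nhds
  filter_upwards [hW, htr, self_mem_nhdsWithin] with t h1 h2 h4
  have h4 : 0 < t := h4
  refine ⟨fun hmem => ?_, h1⟩
  obtain ⟨j, hj, hmem⟩ := mem_trace.1 hmem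
  rcases Nat.eq_zero_or_pos j with rfl | hj0
  -- The two edges at the vertex are avoided because `b` is parallel to neither of them.
  · obtain ⟨s, -, -, hs⟩ := exists_of_mem_segment hmem
    have h5 : (t : ℂ) * b = s * f := by linear_combination hs
    have h6 : t * cross f g = 0 := by
      have h7 := congrArg (cross f) h5
      simp [cross, hb] at h7
      simp only [cross]; linarith
    rcases mul_eq_zero.1 h6 with h6 | h6
    · exact h4.ne' h6
    · exact hcfg h6
  rcases Nat.lt_or_ge j (n - 1) with hj1 | hj1
  · apply h2 (j - 1) (Finset.mem_range.2 (by omega))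
    rwa [show 0 + 1 + (j - 1) = j by omega, show 0 + 1 + (j - 1 + 1) = j + 1 by omega]
  · have : j = n - 1 := by omega
    subst this
    rw [show n - 1 + 1 = n by omega, hper, segment_symm] at hmem
    obtain ⟨s, -, -, hs⟩ := exists_of_mem_segment hmem
    have h5 : (t : ℂ) * b = s * g := by linear_combination hs
    have h6 : t * cross f g = 0 := by
      have h7 := congrArg (cross g) h5
      simp [cross, hb] at h7
      simp only [cross]; linarith
    rcases mul_eq_zero.1 h6 with h6 | h6
    · exact h4.ne' h6
    · exact hcfg h6

theorem eventually_winding_ne_zero (h : IsSimpleClosed z n) {σ : ℝ} (hσ : σ = 1 ∨ σ = -1)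
    (hT : ∑ i ∈ Finset.range n, exteriorAngle z i = 2 * Real.pi * σ) (k : ℕ)
    (hc : 0 < σ * exteriorAngle z k) :
    ∀ᶠ t : ℝ in 𝓝[>] 0,
      z (k + 1) + t * ((z k - z (k + 1)) + (z (k + 2) - z (k + 1))) ∉ trace z n ∧
      winding z n (z (k + 1) + t * ((z k - z (k + 1)) + (z (k + 2) - z (k + 1)))) ≠ 0 := by
  have h3 := h.three_le
  have hcr : 0 < σ * cross (z (k + 1) - z k) (z (k + 2) - z (k + 1)) := by
    by_contra hle
    have := mul_turn_nonpos hσ (not_lt.1 hle)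
      (turn_ne_pi_of_zero_notMem_segment (h.zero_notMem_segment_edges k))
    exact absurd hc (not_lt.2 this)
  have := (h.shift (k + 1)).eventually_winding_ne_zero_zero hσ (by
    rw [← hT, ← h.sum_exteriorAngle_shift (k + 1)]; rfl) (by
    simp only [show k + 1 + (n - 1) = k + n by omega, h.periodic, add_zero]
    convert hcr using 2
    simp [cross]; ring)
  simp only [show k + 1 + (n - 1) = k + n by omega, h.periodic, add_zero, h.trace_shift,
    h.winding_shift] at this
  filter_upwards [this] with t ht
  rw [add_comm (z k - z (k + 1))]
  exact ht

end IsSimpleClosed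

/-! ### Crossing an edge, and visibility in an oblique frame -/

open Filter

theorem le_of_step {F : ℕ → ℝ} {a b : ℕ} (hab : a ≤ b)
    (hF : ∀ j, a ≤ j → j < b → F j ≤ F (j + 1)) : F a ≤ F b := by
  induction b, hab using Nat.le_induction with
  | base => exact le_rfl
  | succ b hab ih => exact (ih fun j h1 h2 => hF j h1 (by omega)).trans (hF b hab (by omega))

theorem lt_of_step {F : ℕ → ℝ} {a b : ℕ} (hab : a < b)
    (hF : ∀ j, a ≤ j → j < b → F j < F (j + 1)) : F a < F b :=
  (hF a le_rfl hab).trans_le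
    (le_of_step (F := F) (a := a + 1) hab fun j h1 h2 => (hF j (by omega) h2).le)

theorem exists_sign_change {F : ℕ → ℝ} {a b : ℕ} (hab : a < b) (ha : F a ≤ 0) (hb : 0 < F b) :
    ∃ m, a ≤ m ∧ m < b ∧ F m ≤ 0 ∧ 0 < F (m + 1) := by
  by_contra! hcon
  have : ∀ j, a ≤ j → j ≤ b → F j ≤ 0 := by
    intro j hj
    induction j, hj using Nat.le_induction with
    | base => exact fun _ => ha
    | succ j hj ih => exact fun hjb => hcon j hj (by omega) (ih (by omega))
  exact absurd hb (not_lt.2 (this b hab.le le_rfl))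

/-- The winding number jumps across an edge. -/
theorem not_eventually_winding_eq_zero {z : ℕ → ℂ} {n m : ℕ} (hm : m < n) {x₀ d : ℂ} {l : ℝ}
    (hl0 : 0 < l) (hl1 : l < 1) (hx₀ : x₀ = z m + l * (z (m + 1) - z m))
    (hother : ∀ j < n, j ≠ m → x₀ ∉ segment ℝ (z j) (z (j + 1)))
    (hd : 0 < cross (z (m + 1) - z m) d) :
    ¬ ∀ᶠ t : ℝ in 𝓝[≠] 0, winding z n (x₀ + t * d) = 0 := by
  intro hev
  set E := z (m + 1) - z m with hE
  have hE0 : E ≠ 0 := by rintro h; simp [h, cross] at hd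
  let S : ℝ → ℝ := fun t => ∑ j ∈ (Finset.range n).erase m,
    turn (z j - (x₀ + t * d)) (z (j + 1) - (x₀ + t * d))
  let r : ℝ → ℂ := fun t => (z (m + 1) - (x₀ + t * d)) / (z m - (x₀ + t * d))
  have hlim : Tendsto (fun t : ℝ => x₀ + t * d) (𝓝 0) (𝓝 x₀) := by
    have : ContinuousAt (fun t : ℝ => x₀ + t * d) 0 := by fun_prop
    simpa [ContinuousAt] using this
  have hS : ContinuousAt S 0 := by
    apply tendsto_finsetSum
    intro j hj
    rw [Finset.mem_erase, Finset.mem_range] at hj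
    have := (continuousAt_turn_sub (hother j hj.2 hj.1)).tendsto.comp hlim
    simpa [Function.comp_def] using this
  have hl : (l : ℂ) ≠ 0 := by exact_mod_cast hl0.ne'
  have ha : z m - x₀ = -(l * E) := by rw [hx₀]; ring
  have hb : z (m + 1) - x₀ = (1 - l) * E := by rw [hx₀, hE]; ring
  have hr0 : r 0 = ((-((1 - l) / l) : ℝ) : ℂ) := by
    simp only [r, ofReal_zero, zero_mul, add_zero, ha, hb]
    push_cast
    field_simp
  have hrc : ContinuousAt r 0 := by
    refine ContinuousAt.div (by fun_prop) (by fun_prop) ?_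
    simp only [ofReal_zero, zero_mul, add_zero, ha]
    exact neg_ne_zero.2 (mul_ne_zero hl hE0)
  have hre : (r 0).re < 0 := by
    rw [hr0, ofReal_re]
    have : 0 < (1 - l) / l := div_pos (by linarith) hl0
    linarith
  have him0 : (r 0).im = 0 := by rw [hr0, ofReal_im]
  have him : ∀ t, (r t).im = t * cross E d / normSq (z m - (x₀ + t * d)) := by
    intro t
    simp only [r, im_div_eq]
    congr 1
    rw [show z m - (x₀ + t * d) = -(l * E) - t * d by rw [← ha]; ring,
      show z (m + 1) - (x₀ + t * d) = (1 - l) * E - t * d by rw [← hb]; ring]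
    simp [cross]
    ring
  have hsum : ∀ t : ℝ, winding z n (x₀ + t * d) = S t + arg (r t) := fun t =>
    (Finset.sum_erase_add _ _ (Finset.mem_range.2 hm)).symm
  -- The other edges contribute the continuous term `S`. If the sum vanished on both sides, `arg (r
  -- t)` would have one two-sided limit; but `r` crosses the negative real axis, so its one-sided
  -- limits are `π` and `-π`.
  have harg : Tendsto (fun t => arg (r t)) (𝓝[≠] 0) (𝓝 (-S 0)) := by
    refine (hS.neg.tendsto.mono_left nhdsWithin_le_nhds).congr' ?_
    filter_upwards [hev] with t ht
    rw [hsum] at ht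
    simp only [Pi.neg_apply]
    linarith
  have hnz : ∀ᶠ t : ℝ in 𝓝 0, 0 < normSq (z m - (x₀ + t * d)) := by
    have : ContinuousAt (fun t : ℝ => z m - (x₀ + t * d)) 0 := by fun_prop
    filter_upwards [this.eventually_ne (y := 0) (by
      simp only [ofReal_zero, zero_mul, add_zero, ha]
      exact neg_ne_zero.2 (mul_ne_zero hl hE0))] with t ht
    exact normSq_pos.2 ht
  have h1 : Tendsto (fun t => arg (r t)) (𝓝[>] 0) (𝓝 Real.pi) := by
    refine (tendsto_arg_nhdsWithin_im_nonneg_of_re_neg_of_im_zero hre him0).comp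
      (tendsto_nhdsWithin_iff.2 ⟨hrc.tendsto.mono_left nhdsWithin_le_nhds, ?_⟩)
    filter_upwards [self_mem_nhdsWithin, nhdsWithin_le_nhds hnz] with t ht hn
    have ht : 0 < t := ht
    change 0 ≤ (r t).im
    rw [him]
    positivity
  have h2 : Tendsto (fun t => arg (r t)) (𝓝[<] 0) (𝓝 (-Real.pi)) := by
    refine (tendsto_arg_nhdsWithin_im_neg_of_re_neg_of_im_zero hre him0).comp
      (tendsto_nhdsWithin_iff.2 ⟨hrc.tendsto.mono_left nhdsWithin_le_nhds, ?_⟩)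
    filter_upwards [self_mem_nhdsWithin, nhdsWithin_le_nhds hnz] with t ht hn
    have ht : t < 0 := ht
    change (r t).im < 0
    rw [him]
    exact div_neg_of_neg_of_pos (mul_neg_of_neg_of_pos ht hd) hn
  have e1 := tendsto_nhds_unique h1 (harg.mono_left (nhdsWithin_mono _ fun t ht => ne_of_gt ht))
  have e2 := tendsto_nhds_unique h2 (harg.mono_left (nhdsWithin_mono _ fun t ht => ne_of_lt ht))
  linarith [Real.pi_pos]

/-- `q` is reached from `p` along a segment in the inside of the closed path `z 0, …, z n`. -/
def Sees (z : ℕ → ℂ) (n : ℕ) (p q : ℂ) : Prop :=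
  ∀ t : ℝ, 0 < t → t < 1 →
    p + t * (q - p) ∉ trace z n ∧ winding z n (p + t * (q - p)) ≠ 0

set_option maxHeartbeats 1000000 in
/-- If, in some oblique frame, a closed path has one chain below `p`, one strictly rising chain that
passes to the right of `p` and one strictly falling chain that passes to the left of `p`, then
`p` sees inner points of the two latter chains. -/
theorem exists_sees_of_frame {z : ℕ → ℂ} {n : ℕ} (hper : z n = z 0)
    {s₁ s₂ : ℕ} (h12 : s₁ < s₂) (h2n : s₂ < n) (h01 : 0 < s₁) {p ε : ℂ} (X H : ℂ →ₗ[ℝ] ℝ)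
    (hXε : X ε = 1) (hHε : H ε = 0) (hinj : ∀ x, X x = 0 → H x = 0 → x = 0)
    {σ : ℝ} (hσ : σ = 1 ∨ σ = -1) (hcross : ∀ x, cross x ε = -σ * H x)
    (hB₁ : ∀ j < s₁, ∀ x ∈ segment ℝ (z j) (z (j + 1)), H (x - p) ≤ 0)
    (hB₂ : ∀ j, s₁ ≤ j → j < s₂ → 0 < H (z (j + 1) - z j))
    (hB₃ : ∀ j, s₂ ≤ j → j < n → H (z (j + 1) - z j) < 0)
    (htop : 0 < H (z s₂ - p))
    (hright : ∀ j, s₁ ≤ j → j < s₂ → ∀ x ∈ segment ℝ (z j) (z (j + 1)), H (x - p) = 0 →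
      0 < X (x - p))
    (hleft : ∀ j, s₂ ≤ j → j < n → ∀ x ∈ segment ℝ (z j) (z (j + 1)), H (x - p) = 0 →
      X (x - p) < 0) :
    (∃ q j, s₁ ≤ j ∧ j < s₂ ∧ q ∈ segment ℝ (z j) (z (j + 1)) ∧ q ≠ z s₁ ∧ q ≠ z s₂ ∧
      Sees z n p q) ∧
    (∃ q j, s₂ ≤ j ∧ j < n ∧ q ∈ segment ℝ (z j) (z (j + 1)) ∧ q ≠ z s₂ ∧ q ≠ z n ∧
      Sees z n p q) := by
  have hn : 0 < n := by omega
  have hstep : ∀ j, H (z (j + 1) - p) = H (z j - p) + H (z (j + 1) - z j) := by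
    intro j; rw [← map_add]; congr 1; ring
  have hs₁ : H (z s₁ - p) ≤ 0 := by
    have := hB₁ (s₁ - 1) (by omega) _ (right_mem_segment ℝ _ _)
    rwa [Nat.sub_add_cancel h01] at this
  have hn0 : H (z n - p) ≤ 0 := hper ▸ hB₁ 0 h01 _ (left_mem_segment ℝ _ _)
  obtain ⟨m, hm1, hm2, hmle, hmlt⟩ :=
    exists_sign_change (F := fun j => H (z j - p)) h12 hs₁ htop
  obtain ⟨m', hm1', hm2', hmle', hmlt'⟩ : ∃ m, s₂ ≤ m ∧ m < n ∧ 0 < H (z m - p) ∧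
      H (z (m + 1) - p) ≤ 0 := by
    by_contra! hcon
    have : ∀ j, s₂ ≤ j → j ≤ n → 0 < H (z j - p) := by
      intro j hj
      induction j, hj using Nat.le_induction with
      | base => exact fun _ => htop
      | succ j hj ih => exact fun hjb => hcon j hj (by omega) (ih (by omega))
    exact absurd (this n h2n.le le_rfl) (not_lt.2 hn0)
  have hup : ∀ i j, s₁ ≤ i → i ≤ j → j ≤ s₂ → H (z i - p) ≤ H (z j - p) := fun i j hi hij hj =>
    le_of_step (F := fun j => H (z j - p)) hij fun k h1 h2 => by
      have := hB₂ k (by omega) (by omega)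
      simp only [hstep]; linarith
  have hdown : ∀ i j, s₂ ≤ i → i ≤ j → j ≤ n → H (z j - p) ≤ H (z i - p) := fun i j hi hij hj => by
    have := le_of_step (F := fun j => -H (z j - p)) hij fun k h1 h2 => by
      have := hB₃ k (by omega) (by omega)
      simp only [hstep]; linarith
    linarith
  set E := z (m + 1) - z m with hE
  set E' := z (m' + 1) - z m' with hE'
  have hHE : 0 < H E := hB₂ m hm1 hm2
  have hHE' : H E' < 0 := hB₃ m' hm1' hm2'
  have hstepm := hstep m
  have hstepm' := hstep m'
  -- the points of the two steep edges at the height `y`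
  let b : ℝ → ℂ := fun y => z m + ((y - H (z m - p)) / H E : ℝ) * E
  let c : ℝ → ℂ := fun y => z m' + ((y - H (z m' - p)) / H E' : ℝ) * E'
  have hHb : ∀ y, H (b y - p) = y := by
    intro y
    have : b y - p = (z m - p) + ((y - H (z m - p)) / H E) • E := by
      simp only [b, real_smul]; ring
    rw [this, map_add, map_smul, smul_eq_mul, div_mul_cancel₀ _ hHE.ne']
    ring
  have hHc : ∀ y, H (c y - p) = y := by
    intro y
    have : c y - p = (z m' - p) + ((y - H (z m' - p)) / H E') • E' := by
      simp only [c, real_smul]; ring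
    rw [this, map_add, map_smul, smul_eq_mul, div_mul_cancel₀ _ hHE'.ne]
    ring
  have hXb : ∀ y, X (b y - p) = X (b 0 - p) + y * (X E / H E) := by
    intro y
    have : b y - p = (b 0 - p) + (y / H E) • E := by
      simp only [b, real_smul]; push_cast; ring
    rw [this, map_add, map_smul, smul_eq_mul]; ring
  have hXc : ∀ y, X (c y - p) = X (c 0 - p) + y * (X E' / H E') := by
    intro y
    have : c y - p = (c 0 - p) + (y / H E') • E' := by
      simp only [c, real_smul]; push_cast; ring
    rw [this, map_add, map_smul, smul_eq_mul]; ring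
  have hbseg : ∀ y, 0 ≤ y → y ≤ H (z (m + 1) - p) → b y ∈ segment ℝ (z m) (z (m + 1)) := by
    intro y h0 h1
    exact mem_segment_of (div_nonneg (by linarith) hHE.le) ((div_le_one hHE).2 (by linarith))
  have hcseg : ∀ y, 0 ≤ y → y ≤ H (z m' - p) → c y ∈ segment ℝ (z m') (z (m' + 1)) := by
    intro y h0 h1
    exact mem_segment_of (div_nonneg_of_nonpos (by linarith) hHE'.le)
      ((div_le_one_of_neg hHE').2 (by linarith))
  have hb0 := hright m hm1 hm2 _ (hbseg 0 le_rfl hmlt.le) (hHb 0)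
  have hc0 := hleft m' hm1' hm2' _ (hcseg 0 le_rfl hmle'.le) (hHc 0)
  have hseg : ∀ j x, x ∈ segment ℝ (z j) (z (j + 1)) → ∃ t : ℝ, 0 ≤ t ∧ t ≤ 1 ∧
      x = z j + t * (z (j + 1) - z j) ∧ H (x - p) = H (z j - p) + t * H (z (j + 1) - z j) := by
    intro j x hx
    obtain ⟨t, h0, h1, rfl⟩ := exists_of_mem_segment hx
    refine ⟨t, h0, h1, rfl, ?_⟩
    rw [show z j + t * (z (j + 1) - z j) - p = (z j - p) + t • (z (j + 1) - z j) by
      rw [real_smul]; ring, map_add, map_smul, smul_eq_mul]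
  -- below the height of the upper ends of these edges, nothing else lies above `p`
  have hrow' : ∀ j < n, ∀ x ∈ segment ℝ (z j) (z (j + 1)), 0 < H (x - p) →
      H (x - p) < H (z (m + 1) - p) → H (x - p) < H (z m' - p) →
      (j = m ∧ x = b (H (x - p))) ∨ (j = m' ∧ x = c (H (x - p))) := by
    intro j hj x hx h0 h1 h2
    obtain ⟨t, ht0, ht1, hxt, hHx⟩ := hseg j x hx
    rcases Nat.lt_or_ge j s₁ with hj1 | hj1
    · exact absurd h0 (not_lt.2 (hB₁ j hj1 x hx))
    rcases Nat.lt_or_ge j s₂ with hj2 | hj2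
    · left
      have hs := hstep j
      have hpos := hB₂ j hj1 hj2
      rcases Nat.lt_trichotomy j m with hjm | rfl | hjm
      · have := hup (j + 1) m (by omega) (by omega) (by omega)
        nlinarith
      · refine ⟨rfl, ?_⟩
        simp only [b]
        rw [hHx, add_sub_cancel_left, mul_div_cancel_right₀ _ hpos.ne']
        exact hxt
      · have := hup (m + 1) j (by omega) (by omega) (by omega)
        nlinarith
    · right
      have hs := hstep j
      have hneg := hB₃ j hj2 hj
      rcases Nat.lt_trichotomy j m' with hjm | rfl | hjm
      · have := hdown (j + 1) m' (by omega) (by omega) (by omega)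
        nlinarith
      · refine ⟨rfl, ?_⟩
        simp only [c]
        rw [hHx, add_sub_cancel_left, mul_div_cancel_right₀ _ hneg.ne]
        exact hxt
      · have := hdown (m' + 1) j (by omega) (by omega) (by omega)
        nlinarith
  -- A height small enough that both steep edges still reach it and remain on their own sides of
  -- `p`. Positions on these edges are affine in the height, so the signs at `0` and `h` give the
  -- signs between.
  obtain ⟨h, hh0, hhm, hhm', hhb, hhc⟩ : ∃ h : ℝ, 0 < h ∧ h < H (z (m + 1) - p) ∧
      h < H (z m' - p) ∧ 0 < X (b h - p) ∧ X (c h - p) < 0 := by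
    have e1 : ∀ᶠ h : ℝ in 𝓝 0, h < H (z (m + 1) - p) := gt_mem_nhds hmlt
    have e2 : ∀ᶠ h : ℝ in 𝓝 0, h < H (z m' - p) := gt_mem_nhds hmle'
    have e3 : ∀ᶠ h : ℝ in 𝓝 0, 0 < X (b 0 - p) + h * (X E / H E) :=
      (show ContinuousAt (fun h : ℝ => X (b 0 - p) + h * (X E / H E)) 0 by fun_prop).tendsto.eventually
        (lt_mem_nhds (by simpa using hb0))
    have e4 : ∀ᶠ h : ℝ in 𝓝 0, X (c 0 - p) + h * (X E' / H E') < 0 :=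
      (show ContinuousAt (fun h : ℝ => X (c 0 - p) + h * (X E' / H E')) 0 by fun_prop).tendsto.eventually
        (gt_mem_nhds (by simpa using hc0))
    obtain ⟨h, ⟨h1, h2, h3, h4⟩, h5⟩ := ((((e1.and (e2.and (e3.and e4))).filter_mono
      (nhdsWithin_le_nhds (s := Set.Ioi 0))).and self_mem_nhdsWithin).exists)
    exact ⟨h, h5, h1, h2, by rwa [hXb], by rwa [hXc]⟩
  have hbpos : ∀ y, 0 ≤ y → y ≤ h → 0 < X (b y - p) := by
    intro y h0 h1
    rw [hXb] at hhb ⊢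
    by_contra hle
    rw [not_lt] at hle
    have : X E / H E < 0 := by nlinarith
    nlinarith
  have hcneg : ∀ y, 0 ≤ y → y ≤ h → X (c y - p) < 0 := by
    intro y h0 h1
    rw [hXc] at hhc ⊢
    by_contra hle
    rw [not_lt] at hle
    have : 0 < X E' / H E' := by nlinarith
    nlinarith
  have hrow : ∀ x, 0 < H (x - p) → H (x - p) ≤ h → x ∈ trace z n →
      X (x - p) = X (b (H (x - p)) - p) ∨ X (x - p) = X (c (H (x - p)) - p) := by
    intro x h0 h1 hx
    obtain ⟨j, hj, hx⟩ := mem_trace.1 hx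
    rcases hrow' j hj x hx h0 (by linarith) (by linarith) with ⟨-, h⟩ | ⟨-, h⟩
    · left; rw [← h]
    · right; rw [← h]
  -- the points between the two edges are inside
  have hin : ∀ x, 0 < H (x - p) → H (x - p) ≤ h → X (c (H (x - p)) - p) < X (x - p) →
      X (x - p) < X (b (H (x - p)) - p) → x ∉ trace z n ∧ winding z n x ≠ 0 := by
    intro x h0 h1 h2 h3
    refine ⟨fun hx => by rcases hrow x h0 h1 hx with h | h <;> linarith, fun hw => ?_⟩
    generalize hy : H (x - p) = y at *
    have hXt : ∀ t : ℝ, X (b y + t * ε - p) = X (b y - p) + t := by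
      intro t
      rw [show b y + t * ε - p = (b y - p) + t • ε by rw [real_smul]; ring, map_add, map_smul, hXε]
      simp
    have hHt : ∀ t : ℝ, H (b y + t * ε - p) = y := by
      intro t
      rw [show b y + t * ε - p = (b y - p) + t • ε by rw [real_smul]; ring, map_add, map_smul, hHε,
        hHb]
      simp
    have hnot : ∀ t : ℝ, t ≠ 0 → X (x - p) - X (b y - p) ≤ t → b y + t * ε ∉ trace z n := by
      intro t ht0 ht hmem
      have := hrow _ (by rwa [hHt]) (by rwa [hHt]) hmem
      rw [hXt, hHt] at this
      rcases this with h | h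
      · exact ht0 (by linarith)
      · linarith
    have hε0 : ε ≠ 0 := by rintro rfl; simp at hXε
    -- To the right of the rising edge, the horizontal ray escapes to infinity without meeting the
    -- path.
    have hpos : ∀ t : ℝ, 0 < t → winding z n (b y + t * ε) = 0 := by
      intro t ht
      refine winding_eq_zero_of_ray hn hper hε0 fun s hs => ?_
      rw [show b y + t * ε + s * ε = b y + ((t + s : ℝ) : ℂ) * ε by push_cast; ring]
      exact hnot _ (by positivity) (by linarith)
    have hx : x = b y + ((X (x - p) - X (b y - p) : ℝ) : ℂ) * ε := by
      rw [← sub_eq_zero]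
      apply hinj
      · have := hXt (X (x - p) - X (b y - p))
        rw [show x - (b y + ((X (x - p) - X (b y - p) : ℝ) : ℂ) * ε) =
          (x - p) - (b y + ((X (x - p) - X (b y - p) : ℝ) : ℂ) * ε - p) by ring, map_sub, this]
        ring
      · have := hHt (X (x - p) - X (b y - p))
        rw [show x - (b y + ((X (x - p) - X (b y - p) : ℝ) : ℂ) * ε) =
          (x - p) - (b y + ((X (x - p) - X (b y - p) : ℝ) : ℂ) * ε - p) by ring, map_sub, this, hy,
          sub_self]
    -- If the winding number vanished at `x`, it would vanish on the row from `x` up to the rising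
    -- edge, hence on both sides of that edge, which the jump forbids.
    have hneg : ∀ t : ℝ, t < 0 → X (x - p) - X (b y - p) ≤ t → winding z n (b y + t * ε) = 0 := by
      intro t ht0 ht
      rw [← hw]
      refine winding_eq_of_isPreconnected hn hper
        (S := (fun t : ℝ => b y + t * ε) '' Set.Ico (X (x - p) - X (b y - p)) 0)
        (isPreconnected_Ico.image _ (by fun_prop)) ?_ ⟨t, ⟨ht, ht0⟩, rfl⟩
        ⟨_, ⟨le_rfl, by linarith⟩, hx.symm⟩
      rintro _ ⟨s, hs, rfl⟩
      exact hnot s hs.2.ne hs.1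
    have hlpos : 0 < (y - H (z m - p)) / H E := div_pos (by linarith) hHE
    have hl1 : (y - H (z m - p)) / H E < 1 := (div_lt_one hHE).2 (by linarith)
    -- The crossing direction is horizontal; the factor `-σ` makes its cross product with the edge
    -- equal to `H E > 0`.
    refine not_eventually_winding_eq_zero (z := z) (n := n) (m := m) (by omega) (x₀ := b y)
      (d := -(σ * ε)) hlpos hl1 rfl ?_ ?_ ?_
    · intro j hj hjm hmem
      rcases hrow' j hj _ hmem (by rwa [hHb]) (by rw [hHb]; linarith) (by rw [hHb]; linarith) with
        ⟨h, -⟩ | ⟨-, h⟩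
      · exact hjm h
      · rw [hHb] at h
        have e1 := hbpos y h0.le h1
        have e2 := hcneg y h0.le h1
        rw [h] at e1
        linarith
    · have e1 : cross E (-(σ * ε)) = -σ * cross E ε := by simp [cross]; ring
      rw [e1, hcross]
      rcases hσ with rfl | rfl <;> linarith
    · have hδ : 0 < X (b y - p) - X (x - p) := by linarith
      have e1 : ∀ᶠ t : ℝ in 𝓝[≠] 0, |t| < X (b y - p) - X (x - p) :=
        nhdsWithin_le_nhds ((show ContinuousAt (fun t : ℝ => |t|) 0 by fun_prop).tendsto.eventually
        (gt_mem_nhds (by simpa using hδ)))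
      filter_upwards [e1, self_mem_nhdsWithin] with t ht ht0
      have ht0 : t ≠ 0 := ht0
      rw [show b y + t * -(σ * ε) = b y + ((-(σ * t) : ℝ) : ℂ) * ε by push_cast; ring]
      rw [abs_lt] at ht
      have key : ∀ s : ℝ, s ≠ 0 → X (x - p) - X (b y - p) ≤ s →
          winding z n (b y + s * ε) = 0 := by
        intro s hs0 hs
        rcases lt_or_gt_of_ne hs0 with h | h
        · exact hneg s h hs
        · exact hpos s h
      rcases hσ with rfl | rfl
      · exact key _ (by simpa using ht0) (by linarith)
      · exact key _ (by simpa using ht0) (by linarith)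
  have hline : ∀ (q : ℂ) (t : ℝ), p + t * (q - p) - p = t • (q - p) := by
    intro q t; rw [real_smul]; ring
  refine ⟨⟨b h, m, hm1, hm2, hbseg h hh0.le hhm.le, ?_, ?_, ?_⟩,
    ⟨c h, m', hm1', hm2', hcseg h hh0.le hhm'.le, ?_, ?_, ?_⟩⟩
  · intro he
    have := hHb h
    rw [he] at this; linarith
  · intro he
    have := hHb h
    have := hup (m + 1) s₂ (by omega) hm2 le_rfl
    rw [he] at *; linarith
  · intro t ht0 ht1
    have e1 := hHb h
    have e2 := hbpos h hh0.le le_rfl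
    have hth : 0 < t * h := mul_pos ht0 hh0
    have hth1 : t * h ≤ h := mul_le_of_le_one_left hh0.le ht1.le
    have e3 := hcneg (t * h) hth.le hth1
    have e4 := hXb h
    have hH : H (p + t * (b h - p) - p) = t * h := by rw [hline, map_smul, e1, smul_eq_mul]
    have hX : X (p + t * (b h - p) - p) = t * X (b h - p) := by rw [hline, map_smul, smul_eq_mul]
    apply hin
    · rwa [hH]
    · rwa [hH]
    · rw [hH, hX]; exact e3.trans (mul_pos ht0 e2)
    -- At height `t * h`, the segment stays left of the rising edge by exactly `(1 - t) * X (b 0 -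
    -- p)`.
    · rw [hH, hX, hXb (t * h), e4]; linear_combination mul_pos (sub_pos.2 ht1) hb0
  · intro he
    have := hHc h
    have := hdown s₂ m' le_rfl hm1' (by omega)
    rw [he] at *; linarith
  · intro he
    have := hHc h
    rw [he] at this; linarith
  · intro t ht0 ht1
    have e1 := hHc h
    have e2 := hcneg h hh0.le le_rfl
    have hth : 0 < t * h := mul_pos ht0 hh0
    have hth1 : t * h ≤ h := mul_le_of_le_one_left hh0.le ht1.le
    have e3 := hbpos (t * h) hth.le hth1
    have e4 := hXc h
    have hH : H (p + t * (c h - p) - p) = t * h := by rw [hline, map_smul, e1, smul_eq_mul]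
    have hX : X (p + t * (c h - p) - p) = t * X (c h - p) := by rw [hline, map_smul, smul_eq_mul]
    apply hin
    · rwa [hH]
    · rwa [hH]
    · rw [hH, hX, hXc (t * h), e4]; linear_combination mul_neg_of_pos_of_neg (sub_pos.2 ht1) hc0
    · rw [hH, hX]; exact (mul_neg_of_pos_of_neg ht0 e2).trans e3

/-! ### Edge directions, and the frame of the edge through the given point -/

/-- The angle by which the direction of the path has turned from the edge `0` to the edge `j`. -/
noncomputable def edgeAngle (z : ℕ → ℂ) (j : ℕ) : ℝ :=
  ∑ i ∈ Finset.range j, exteriorAngle z i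

theorem edgeAngle_succ (z : ℕ → ℂ) (j : ℕ) :
    edgeAngle z (j + 1) = edgeAngle z j + exteriorAngle z j :=
  Finset.sum_range_succ _ _

namespace IsSimpleClosed

variable {z : ℕ → ℂ} {n : ℕ}

theorem edge_eq (h : IsSimpleClosed z n) (j : ℕ) :
    z (j + 1) - z j = ‖z (j + 1) - z j‖ * exp (edgeAngle z j * I) *
      ((z 1 - z 0) / ‖z 1 - z 0‖) := by
  induction j with
  | zero =>
    have : (‖z 1 - z 0‖ : ℂ) ≠ 0 := by
      exact_mod_cast (norm_pos_iff.2 (sub_ne_zero.2 (h.ne 0).symm)).ne'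
    simp only [edgeAngle, Finset.range_zero, Finset.sum_empty, ofReal_zero, zero_mul, exp_zero,
      mul_one, zero_add]
    field_simp
  | succ j ih =>
    have hj : z (j + 1) - z j ≠ 0 := sub_ne_zero.2 (h.ne j).symm
    have hn : (‖z (j + 1) - z j‖ : ℂ) ≠ 0 := by
      exact_mod_cast (norm_pos_iff.2 hj).ne'
    have h1 := norm_mul_exp_arg_mul_I ((z (j + 2) - z (j + 1)) / (z (j + 1) - z j))
    have h2 : (‖(z (j + 2) - z (j + 1)) / (z (j + 1) - z j)‖ : ℂ) * ‖z (j + 1) - z j‖ =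
        ‖z (j + 2) - z (j + 1)‖ := by
      rw [norm_div, ofReal_div, div_mul_cancel₀ _ hn]
    rw [eq_div_iff hj] at h1
    rw [edgeAngle_succ, exteriorAngle, turn, ofReal_add, add_mul, exp_add]
    generalize ((z (j + 2) - z (j + 1)) / (z (j + 1) - z j)) = r at *
    linear_combination -h1 + (‖r‖ : ℂ) * exp (arg r * I) * ih +
      exp (edgeAngle z j * I) * exp (arg r * I) * ((z 1 - z 0) / ‖z 1 - z 0‖) * h2

/-- Rotate so that edge `k` points along the positive real axis and take real and imaginary parts.
The factor `σ` on the latter reflects clockwise polygons, so both orientations look counterclockwise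
in the frame. -/
theorem exists_frame (h : IsSimpleClosed z n) {σ : ℝ} (hσ : σ = 1 ∨ σ = -1) (k : ℕ) :
    ∃ (X H : ℂ →ₗ[ℝ] ℝ) (ε : ℂ), X ε = 1 ∧ H ε = 0 ∧ (∀ x, X x = 0 → H x = 0 → x = 0) ∧
      (∀ x, cross x ε = -σ * H x) ∧
      ∀ j, X (z (j + 1) - z j) =
          ‖z (j + 1) - z j‖ * Real.cos (σ * edgeAngle z j - σ * edgeAngle z k) ∧
        H (z (j + 1) - z j) =
          ‖z (j + 1) - z j‖ * Real.sin (σ * edgeAngle z j - σ * edgeAngle z k) := by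
  set w := (z 1 - z 0) / ‖z 1 - z 0‖ with hw
  have hw1 : w * (starRingEnd ℂ) w = 1 := by
    have : ‖w‖ = 1 := by
      rw [hw, norm_div, norm_real, norm_norm, div_self]
      exact (norm_pos_iff.2 (sub_ne_zero.2 (h.ne 0).symm)).ne'
    rw [mul_conj, normSq_eq_norm_sq, this]; norm_num
  set ε := exp (edgeAngle z k * I) * w with hε
  have hεc : (starRingEnd ℂ) ε = exp (-(edgeAngle z k * I)) * (starRingEnd ℂ) w := by
    rw [hε, map_mul, ← exp_conj]; simp
  have hε1 : ε * (starRingEnd ℂ) ε = 1 := by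
    rw [hεc, hε, show exp (edgeAngle z k * I) * w * (exp (-(edgeAngle z k * I)) *
      (starRingEnd ℂ) w) = (exp (edgeAngle z k * I) * exp (-(edgeAngle z k * I))) *
      (w * (starRingEnd ℂ) w) by ring, hw1, ← exp_add]
    simp
  let L := LinearMap.mulRight ℝ ((starRingEnd ℂ) ε)
  have hσ2 : σ * σ = 1 := by rcases hσ with rfl | rfl <;> norm_num
  have hσ0 : σ ≠ 0 := by rintro rfl; norm_num at hσ2
  refine ⟨reLm ∘ₗ L, σ • (imLm ∘ₗ L), ε, ?_, ?_, ?_, ?_, ?_⟩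
  · simp [L, hε1]
  · simp [L, hε1]
  · intro x hx hy
    have hy' : (x * (starRingEnd ℂ) ε).im = 0 := by
      have : σ * (x * (starRingEnd ℂ) ε).im = 0 := hy
      exact (mul_eq_zero.1 this).resolve_left hσ0
    have h0 : x * (starRingEnd ℂ) ε = 0 := Complex.ext hx hy'
    rcases mul_eq_zero.1 h0 with h0 | h0
    · exact h0
    · rw [h0, mul_zero] at hε1; exact absurd hε1 zero_ne_one
  · intro x
    have : -σ * (σ • (imLm ∘ₗ L)) x = -(σ * σ) * (x * (starRingEnd ℂ) ε).im := by
      simp only [LinearMap.smul_apply, LinearMap.comp_apply, smul_eq_mul]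
      change -σ * (σ * (x * (starRingEnd ℂ) ε).im) = _
      ring
    rw [this, hσ2]
    simp [cross]; ring
  · intro j
    have hE : (z (j + 1) - z j) * (starRingEnd ℂ) ε =
        ‖z (j + 1) - z j‖ * exp ((edgeAngle z j - edgeAngle z k : ℝ) * I) := by
      conv_lhs => rw [h.edge_eq j, hεc, ← hw]
      rw [ofReal_sub, sub_mul, sub_eq_add_neg (_ * I), exp_add]
      linear_combination (‖z (j + 1) - z j‖ : ℂ) * exp (edgeAngle z j * I) *
        exp (-(edgeAngle z k * I)) * hw1
    constructor
    · change ((z (j + 1) - z j) * (starRingEnd ℂ) ε).re = _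
      rw [hE, re_ofReal_mul, exp_ofReal_mul_I_re]
      rcases hσ with rfl | rfl
      · simp
      · rw [← Real.cos_neg]; congr 2; ring
    · change σ * ((z (j + 1) - z j) * (starRingEnd ℂ) ε).im = _
      rw [hE, im_ofReal_mul, exp_ofReal_mul_I_im]
      rcases hσ with rfl | rfl
      · simp
      · rw [show -1 * edgeAngle z j - -1 * edgeAngle z k = -(edgeAngle z j - edgeAngle z k) by ring,
          Real.sin_neg]
        ring

/-- The direction `ψ` gains `2π` around the path, falls weakly along each chain and jumps by less
than `π` at each corner. Measured from edge `k`, this forces it into `(0, π)` on the second chain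
and into `(π, 2π)` on the third, so these chains rise and fall strictly. -/
theorem exists_sees (h : IsSimpleClosed z n) {σ : ℝ} (hσ : σ = 1 ∨ σ = -1)
    (hT : ∑ i ∈ Finset.range n, exteriorAngle z i = 2 * Real.pi * σ)
    {s₁ s₂ : ℕ} (h01 : 0 < s₁) (h12 : s₁ < s₂) (h2n : s₂ < n)
    (hreflex : ∀ j, j + 1 < n → j + 1 ≠ s₁ → j + 1 ≠ s₂ → σ * exteriorAngle z j ≤ 0)
    {k : ℕ} (hk : k < s₁) {p : ℂ} (hp : p ∈ segment ℝ (z k) (z (k + 1)))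
    (hpout : ∀ j, s₁ ≤ j → j < n → p ∉ segment ℝ (z j) (z (j + 1))) :
    (∃ q j, s₁ ≤ j ∧ j < s₂ ∧ q ∈ segment ℝ (z j) (z (j + 1)) ∧ q ≠ z s₁ ∧ q ≠ z s₂ ∧
      Sees z n p q) ∧
    (∃ q j, s₂ ≤ j ∧ j < n ∧ q ∈ segment ℝ (z j) (z (j + 1)) ∧ q ≠ z s₂ ∧ q ≠ z n ∧
      Sees z n p q) := by
  have hper : z n = z 0 := by simpa using h.periodic 0
  obtain ⟨X, H, ε, hXε, hHε, hinj, hcross, hframe⟩ := h.exists_frame hσ k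
  have hnorm : ∀ j, 0 < ‖z (j + 1) - z j‖ := fun j =>
    norm_pos_iff.2 (sub_ne_zero.2 (h.ne j).symm)
  obtain ⟨ψ, hψ⟩ : ∃ ψ : ℕ → ℝ, ∀ j, ψ j = σ * edgeAngle z j := ⟨_, fun _ => rfl⟩
  simp only [← hψ] at hframe
  have hψs : ∀ j, ψ (j + 1) = ψ j + σ * exteriorAngle z j := fun j => by
    rw [hψ, hψ, edgeAngle_succ]; ring
  have hlt : ∀ j, σ * exteriorAngle z j < Real.pi := fun j => by
    have := abs_lt.1 (h.abs_exteriorAngle_lt j)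
    rcases hσ with rfl | rfl <;> linarith
  have hψ0 : ψ 0 = 0 := by simp [hψ, edgeAngle]
  have hψn : ψ n = 2 * Real.pi := by
    rw [hψ, edgeAngle, hT]
    rcases hσ with rfl | rfl <;> ring
  -- the direction turns clockwise along each of the three chains
  have hanti : ∀ i j, i ≤ j → j < n → (∀ l, i < l → l ≤ j → l ≠ s₁ ∧ l ≠ s₂) → ψ j ≤ ψ i := by
    intro i j hij hj hl
    have := le_of_step (F := fun j => -ψ j) hij fun l h1 h2 => by
      have := hl (l + 1) (by omega) (by omega)
      have := hreflex l (by omega) this.1 this.2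
      simp only [hψs]; linarith
    linarith
  have hψ1 : ψ s₁ < ψ (s₁ - 1) + Real.pi := by
    have := hψs (s₁ - 1)
    rw [Nat.sub_add_cancel h01] at this
    linarith [hlt (s₁ - 1)]
  have hψ2 : ψ s₂ < ψ (s₂ - 1) + Real.pi := by
    have := hψs (s₂ - 1)
    rw [Nat.sub_add_cancel (by omega)] at this
    linarith [hlt (s₂ - 1)]
  have hψ3 : ψ n < ψ (n - 1) + Real.pi := by
    have := hψs (n - 1)
    rw [Nat.sub_add_cancel (by omega)] at this
    linarith [hlt (n - 1)]
  have r1 : ∀ i j, i ≤ j → j < s₁ → ψ j ≤ ψ i := fun i j hij hj =>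
    hanti i j hij (by omega) fun l _ _ => by omega
  have r2 : ∀ i j, s₁ ≤ i → i ≤ j → j < s₂ → ψ j ≤ ψ i := fun i j hi hij hj =>
    hanti i j hij (by omega) fun l _ _ => by omega
  have r3 : ∀ i j, s₂ ≤ i → i ≤ j → j < n → ψ j ≤ ψ i := fun i j hi hij hj =>
    hanti i j hij (by omega) fun l _ _ => by omega
  have k0 := r1 0 k (Nat.zero_le _) hk
  have k1 := r1 k (s₁ - 1) (by omega) (by omega)
  have k2 := r2 s₁ (s₂ - 1) le_rfl (by omega) (by omega)
  have k3 := r3 s₂ (n - 1) le_rfl (by omega) (by omega)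
  have hpi := Real.pi_pos
  -- two directions along which the path from `p` to the second corner, and back, advances
  set μ := (ψ (s₁ - 1) + ψ s₁) / 2 - ψ k with hμ
  -- While `μ` lies midway between the directions of the edges at the corner `s₁`, `ν` lies midway
  -- between those at `z 0`, namely `ψ (n - 1) - 2π` and `ψ 0 = 0`. Since the jumps are below `π`,
  -- all edges from `k` to `s₂` are within `π / 2` of `μ`, and all from `s₂` around to `k` within `π
  -- / 2` of `ν`.
  set ν := ψ (n - 1) / 2 - Real.pi - ψ k with hν
  let A : ℂ →ₗ[ℝ] ℝ := Real.cos μ • X + Real.sin μ • H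
  let B : ℂ →ₗ[ℝ] ℝ := Real.cos ν • X + Real.sin ν • H
  have hA : ∀ x, A x = Real.cos μ * X x + Real.sin μ * H x := fun x => rfl
  have hB : ∀ x, B x = Real.cos ν * X x + Real.sin ν * H x := fun x => rfl
  have hAE : ∀ j, A (z (j + 1) - z j) = ‖z (j + 1) - z j‖ * Real.cos (ψ j - ψ k - μ) := by
    intro j; rw [hA, (hframe j).1, (hframe j).2, Real.cos_sub (ψ j - ψ k)]; ring
  have hBE : ∀ j, B (z (j + 1) - z j) = ‖z (j + 1) - z j‖ * Real.cos (ψ j - ψ k - ν) := by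
    intro j; rw [hB, (hframe j).1, (hframe j).2, Real.cos_sub (ψ j - ψ k)]; ring
  have hApos : ∀ j, k ≤ j → j < s₂ → 0 < A (z (j + 1) - z j) := by
    intro j hj1 hj2
    rw [hAE]
    apply mul_pos (hnorm j)
    rcases Nat.lt_or_ge j s₁ with hj | hj
    · have e1 := r1 k j hj1 hj
      have e2 := r1 j (s₁ - 1) (by omega) (by omega)
      apply Real.cos_pos_of_mem_Ioo
      constructor <;> linarith
    · have e1 := r2 s₁ j le_rfl hj hj2
      have e2 := r2 j (s₂ - 1) hj (by omega) (by omega)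
      apply Real.cos_pos_of_mem_Ioo
      constructor <;> linarith
  have hBpos₁ : ∀ j, j ≤ k → 0 < B (z (j + 1) - z j) := by
    intro j hj
    rw [hBE]
    apply mul_pos (hnorm j)
    have e1 := r1 0 j (Nat.zero_le _) (by omega)
    have e2 := r1 j k hj hk
    apply Real.cos_pos_of_mem_Ioo
    constructor <;> linarith
  have hBpos₂ : ∀ j, s₂ ≤ j → j < n → 0 < B (z (j + 1) - z j) := by
    intro j hj1 hj2
    rw [hBE]
    apply mul_pos (hnorm j)
    have e1 := r3 s₂ j le_rfl hj1 hj2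
    have e2 := r3 j (n - 1) hj1 (by omega) (by omega)
    rw [← Real.cos_sub_two_pi]
    apply Real.cos_pos_of_mem_Ioo
    constructor <;> linarith
  have hcosμ : 0 < Real.cos μ := by
    apply Real.cos_pos_of_mem_Ioo
    constructor <;> linarith
  have hcosν : 0 < Real.cos ν := by
    apply Real.cos_pos_of_mem_Ioo
    constructor <;> linarith
  have hsin : 0 < Real.sin (μ - ν) := by
    apply Real.sin_pos_of_pos_of_lt_pi <;> linarith
  obtain ⟨t, ht0, ht1, hpt⟩ := exists_of_mem_segment hp
  have hseg : ∀ (F : ℂ →ₗ[ℝ] ℝ) j x, x ∈ segment ℝ (z j) (z (j + 1)) →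
      ∃ s : ℝ, 0 ≤ s ∧ s ≤ 1 ∧ F (x - p) = F (z j - p) + s * F (z (j + 1) - z j) := by
    intro F j x hx
    obtain ⟨s, h0, h1, rfl⟩ := exists_of_mem_segment hx
    refine ⟨s, h0, h1, ?_⟩
    rw [show z j + s * (z (j + 1) - z j) - p = (z j - p) + s • (z (j + 1) - z j) by
      rw [real_smul]; ring, map_add, map_smul, smul_eq_mul]
  have hstep : ∀ (F : ℂ →ₗ[ℝ] ℝ) j, F (z (j + 1) - p) = F (z j - p) + F (z (j + 1) - z j) := by
    intro F j; rw [← map_add]; congr 1; ring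
  have hk0 : ∀ F : ℂ →ₗ[ℝ] ℝ, F (z k - p) = -(t * F (z (k + 1) - z k)) := by
    intro F
    rw [show z k - p = -(t • (z (k + 1) - z k)) by rw [hpt, real_smul]; ring, map_neg, map_smul,
      smul_eq_mul]
  have hAlt : ∀ j, s₁ ≤ j → j < s₂ → ∀ x ∈ segment ℝ (z j) (z (j + 1)), 0 < A (x - p) := by
    intro j hj1 hj2 x hx
    obtain ⟨s, hs0, -, hs⟩ := hseg A j x hx
    have e1 := hApos j (by omega) hj2
    have e2 : 0 < A (z j - p) := by
      have e3 := hk0 A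
      have e4 := hstep A k
      have e5 := hApos k le_rfl (by omega)
      -- Strictness comes from the rest of edge `k`. If `p` is the end of that edge, it is not the
      -- corner `z s₁`, so another whole edge lies before the second chain.
      rcases ht1.lt_or_eq with ht1 | rfl
      · have e6 := le_of_step (F := fun j => A (z j - p)) (show k + 1 ≤ j by omega)
          fun l h1 h2 => by
            have := hApos l (by omega) (by omega)
            simp only [hstep]; linarith
        nlinarith
      · have hk1 : k + 1 ≠ s₁ := by
          intro he
          apply hpout s₁ le_rfl (by omega)
          rw [hpt, ← he]
          convert left_mem_segment ℝ (z (k + 1)) (z (k + 1 + 1)) using 1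
          push_cast; ring
        have e6 := lt_of_step (F := fun j => A (z j - p)) (show k + 1 < j by omega)
          fun l h1 h2 => by
            have := hApos l (by omega) (by omega)
            simp only [hstep]; linarith
        linarith
    rw [hs]
    positivity
  have hBlt : ∀ j, s₂ ≤ j → j < n → ∀ x ∈ segment ℝ (z j) (z (j + 1)), B (x - p) < 0 := by
    intro j hj1 hj2 x hx
    obtain ⟨s, -, hs1, hs⟩ := hseg B j x hx
    have e1 := hBpos₂ j hj1 hj2
    have e2 : B (z (j + 1) - p) ≤ B (z 0 - p) := by
      rw [← hper]
      exact le_of_step (F := fun j => B (z j - p)) (show j + 1 ≤ n by omega) fun l h1 h2 => by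
        have := hBpos₂ l (by omega) (by omega)
        simp only [hstep]; linarith
    have e2' : B (z 0 - p) < 0 := by
      have e3 := hk0 B
      have e5 := hBpos₁ k le_rfl
      rcases ht0.lt_or_eq with ht0 | rfl
      · have e6 := le_of_step (F := fun j => B (z j - p)) (Nat.zero_le k)
          fun l h1 h2 => by
            have := hBpos₁ l (by omega)
            simp only [hstep]; linarith
        have := mul_pos ht0 e5
        linarith
      · have hk1 : k ≠ 0 := by
          rintro rfl
          apply hpout (n - 1) (by omega) (by omega)
          rw [hpt, Nat.sub_add_cancel (by omega), hper]
          convert right_mem_segment ℝ (z (n - 1)) (z 0) using 1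
          push_cast; ring
        have e6 := lt_of_step (F := fun j => B (z j - p)) (show 0 < k by omega)
          fun l h1 h2 => by
            have := hBpos₁ l (by omega)
            simp only [hstep]; linarith
        linarith
    have := hstep B j
    rw [hs]
    nlinarith
  refine exists_sees_of_frame hper h12 h2n h01 X H hXε hHε hinj hσ hcross ?_ ?_ ?_ ?_ ?_ ?_
  · have hHk : H (z (k + 1) - z k) = 0 := by rw [(hframe k).2]; simp
    have hk' : H (z k - p) = 0 := by rw [hk0, hHk]; simp
    have hk1' : H (z (k + 1) - p) = 0 := by rw [hstep, hk', hHk, add_zero]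
    -- Relative to edge `k`, earlier edges of the first chain have directions in `[0, π]` and later
    -- ones in `[-π, 0]`. The chain rises to the line of edge `k` and descends after it.
    have hvert : ∀ j ≤ s₁, H (z j - p) ≤ 0 := by
      intro j hj
      rcases Nat.lt_or_ge k j with hkj | hkj
      · have e6 := le_of_step (F := fun j => -H (z j - p)) (show k + 1 ≤ j by omega)
          fun l h1 h2 => by
            have e1 := r1 k l (by omega) (by omega)
            have e2 := r1 l (s₁ - 1) (by omega) (by omega)
            have e3 : Real.sin (ψ l - ψ k) ≤ 0 :=
              Real.sin_nonpos_of_nonpos_of_neg_pi_le (by linarith) (by linarith)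
            have := mul_nonpos_of_nonneg_of_nonpos (hnorm l).le e3
            simp only [hstep, (hframe l).2]; linarith
        linarith
      · have e6 := le_of_step (F := fun j => H (z j - p)) hkj
          fun l h1 h2 => by
            have e1 := r1 l k (by omega) hk
            have e2 := r1 0 l (Nat.zero_le _) (by omega)
            have e3 : 0 ≤ Real.sin (ψ l - ψ k) :=
              Real.sin_nonneg_of_nonneg_of_le_pi (by linarith) (by linarith)
            have := mul_nonneg (hnorm l).le e3
            simp only [hstep, (hframe l).2]; linarith
        linarith
    intro j hj x hx
    obtain ⟨s, hs0, hs1, hs⟩ := hseg H j x hx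
    have e1 := hvert j (by omega)
    have e2 := hvert (j + 1) (by omega)
    have := hstep H j
    rw [hs]
    nlinarith
  · intro j hj1 hj2
    have e1 := r2 s₁ j le_rfl hj1 hj2
    have e2 := r2 j (s₂ - 1) hj1 (by omega) (by omega)
    rw [(hframe j).2]
    exact mul_pos (hnorm j) (Real.sin_pos_of_pos_of_lt_pi (by linarith) (by linarith))
  · intro j hj1 hj2
    have e1 := r3 s₂ j le_rfl hj1 hj2
    have e2 := r3 j (n - 1) hj1 (by omega) (by omega)
    rw [(hframe j).2, ← Real.sin_sub_two_pi]
    exact mul_neg_of_pos_of_neg (hnorm j)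
      (Real.sin_neg_of_neg_of_neg_pi_lt (by linarith) (by linarith))
  · have e1 := hAlt (s₂ - 1) (by omega) (by omega) _ (right_mem_segment ℝ _ _)
    rw [Nat.sub_add_cancel (by omega)] at e1
    have e2 := hBlt s₂ le_rfl h2n _ (left_mem_segment ℝ _ _)
    -- The second corner is ahead of `p` in the direction `μ` and behind it in the direction `ν`;
    -- eliminating `X` from these two inequalities gives its height.
    have e3 : 0 < H (z s₂ - p) * Real.sin (μ - ν) := by
      have e4 : H (z s₂ - p) * Real.sin (μ - ν) =
          Real.cos ν * A (z s₂ - p) - Real.cos μ * B (z s₂ - p) := by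
        rw [hA, hB, Real.sin_sub]; ring
      rw [e4]
      nlinarith
    exact pos_of_mul_pos_left e3 hsin.le
  · intro j hj1 hj2 x hx hH
    have e1 := hAlt j hj1 hj2 x hx
    rw [hA, hH, mul_zero, add_zero] at e1
    exact pos_of_mul_pos_right e1 hcosμ.le
  · intro j hj1 hj2 x hx hH
    have e1 := hBlt j hj1 hj2 x hx
    rw [hB, hH, mul_zero, add_zero] at e1
    by_contra hle
    exact absurd e1 (not_lt.2 (mul_nonneg hcosν.le (not_lt.1 hle)))

end IsSimpleClosed

/-! ### Transfer to polygons in the Euclidean plane -/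

/-- The Euclidean plane as the complex plane. -/
noncomputable def toComplex : Plane ≃ₗᵢ[ℝ] ℂ := Complex.orthonormalBasisOneI.repr.symm

theorem toComplex_mem_segment {a b x : Plane} :
    toComplex x ∈ segment ℝ (toComplex a) (toComplex b) ↔ x ∈ segment ℝ a b := by
  have := image_segment ℝ (toComplex.toLinearEquiv.toLinearMap.toAffineMap) a b
  have h2 : toComplex '' segment ℝ a b = segment ℝ (toComplex a) (toComplex b) := this
  rw [← h2, toComplex.injective.mem_set_image]

end PlanePath

namespace Polygon

open PlanePath

variable {n : ℕ}

theorem iterate_finRotate_val (i : Fin n) (j : ℕ) :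
    ((finRotate n)^[j] i : ℕ) = (i + j) % n := by
  have hn : 0 < n := i.pos
  obtain ⟨m, rfl⟩ : ∃ m, n = m + 1 := ⟨n - 1, by omega⟩
  induction j with
  | zero => simp [Nat.mod_eq_of_lt i.isLt]
  | succ j ih =>
    rw [Function.iterate_succ_apply', finRotate_apply, Fin.val_add, ih]
    simp [← add_assoc]

theorem iterate_finRotate_eq_iff (i : Fin n) (j k : ℕ) :
    (finRotate n)^[j] i = (finRotate n)^[k] i ↔ j % n = k % n := by
  rw [Fin.ext_iff, iterate_finRotate_val, iterate_finRotate_val]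
  constructor
  · exact fun h => Nat.ModEq.add_left_cancel' (i : ℕ) h
  · exact fun h => Nat.ModEq.add_left (i : ℕ) h

theorem exists_iterate_finRotate_eq (i k : Fin n) : ∃ j < n, (finRotate n)^[j] i = k := by
  have hi := i.isLt
  have hk := k.isLt
  refine ⟨(k + (n - i)) % n, Nat.mod_lt _ i.pos, ?_⟩
  rw [Fin.ext_iff, iterate_finRotate_val, Nat.add_mod_mod, show (i : ℕ) + (k + (n - i)) = k + n by omega,
    Nat.add_mod_right, Nat.mod_eq_of_lt hk]

/-- The vertices of a polygon from the vertex `i` onwards, as complex numbers. -/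
noncomputable def vertexSeq (P : Polygon Plane n) (i : Fin n) (j : ℕ) : ℂ :=
  toComplex (P.vertices ((finRotate n)^[j] i))

theorem edgeSet_eq (P : Polygon Plane n) (k : Fin n) :
    P.edgeSet ℝ k = segment ℝ (P.vertices k) (P.vertices (finRotate n k)) :=
  affineSegment_eq_segment ℝ _ _

theorem toComplex_mem_vertexSeq (P : Polygon Plane n) (i : Fin n) (j : ℕ) (x : Plane) :
    toComplex x ∈ segment ℝ (P.vertexSeq i j) (P.vertexSeq i (j + 1)) ↔
      x ∈ P.edgeSet ℝ ((finRotate n)^[j] i) := by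
  rw [edgeSet_eq, vertexSeq, vertexSeq, toComplex_mem_segment, Function.iterate_succ_apply']

theorem toComplex_mem_trace (P : Polygon Plane n) (i : Fin n) (x : Plane) :
    toComplex x ∈ trace (P.vertexSeq i) n ↔ x ∈ P.boundary ℝ := by
  rw [mem_trace, boundary, Set.mem_iUnion]
  constructor
  · rintro ⟨j, -, hj⟩
    exact ⟨_, (P.toComplex_mem_vertexSeq i j x).1 hj⟩
  · rintro ⟨k, hk⟩
    obtain ⟨j, hj, rfl⟩ := exists_iterate_finRotate_eq i k
    exact ⟨j, hj, (P.toComplex_mem_vertexSeq i j x).2 hk⟩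

theorem vertexSeq_periodic (P : Polygon Plane n) (i : Fin n) (j : ℕ) :
    P.vertexSeq i (j + n) = P.vertexSeq i j := by
  rw [vertexSeq, vertexSeq, (iterate_finRotate_eq_iff i (j + n) j).2 (Nat.add_mod_right _ _)]

theorem IsSimple.isSimpleClosed {P : Polygon Plane n} (hP : P.IsSimple) (i : Fin n) :
    IsSimpleClosed (P.vertexSeq i) n where
  three_le := hP.three_le
  periodic := P.vertexSeq_periodic i
  ne j := by
    rw [vertexSeq, vertexSeq, Function.iterate_succ_apply']
    exact toComplex.injective.ne (hP.nondegenerate _)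
  consecutive j x hx hx' := by
    obtain ⟨y, rfl⟩ := toComplex.surjective x
    rw [toComplex_mem_vertexSeq] at hx
    rw [show j + 2 = j + 1 + 1 by rfl, toComplex_mem_vertexSeq, Function.iterate_succ_apply'] at hx'
    have := (hP.consecutive ((finRotate n)^[j] i)).subset ⟨hx, hx'⟩
    rw [vertexSeq, Function.iterate_succ_apply', Set.mem_singleton_iff.1 this]
  nonconsecutive j k hjk hkj := by
    rw [Set.disjoint_left]
    intro x hx hx'
    obtain ⟨y, rfl⟩ := toComplex.surjective x
    rw [toComplex_mem_vertexSeq] at hx hx'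
    have hmod : ∀ a b, a < b → b < a + n → (finRotate n)^[a] i ≠ (finRotate n)^[b] i := by
      intro a b hab hba he
      rw [iterate_finRotate_eq_iff] at he
      have h1 := (Nat.modEq_iff_dvd' hab.le).1 he
      have h2 := Nat.le_of_dvd (by omega) h1
      omega
    refine Set.disjoint_left.1 (hP.nonconsecutive _ _ ?_ ?_ ?_) hx hx'
    · exact hmod j k (by omega) (by omega)
    · rw [← Function.iterate_succ_apply' (finRotate n)]
      exact (hmod (j + 1) k hjk (by omega)).symm
    · rw [← Function.iterate_succ_apply' (finRotate n)]
      have : (finRotate n)^[j] i = (finRotate n)^[j + n] i :=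
        (iterate_finRotate_eq_iff i _ _).2 (Nat.add_mod_right _ _).symm
      rw [this]
      exact (hmod (k + 1) (j + n) hkj (by omega)).symm

theorem mem_inside_of_winding_ne_zero (P : Polygon Plane n) (i : Fin n) {x : Plane}
    (hx : toComplex x ∉ trace (P.vertexSeq i) n)
    (hw : winding (P.vertexSeq i) n (toComplex x) ≠ 0) : x ∈ P.inside := by
  have hxb : x ∉ P.boundary ℝ := fun h => hx ((P.toComplex_mem_trace i x).2 h)
  refine ⟨hxb, ?_⟩
  have hper : P.vertexSeq i n = P.vertexSeq i 0 := by simpa using P.vertexSeq_periodic i 0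
  have hb := isBounded_of_winding_ne_zero i.pos hper hx hw
  have himg := toComplex.toHomeomorph.image_connectedComponentIn (s := (P.boundary ℝ)ᶜ) hxb
  have hcompl : toComplex '' (P.boundary ℝ)ᶜ = (trace (P.vertexSeq i) n)ᶜ := by
    ext y
    obtain ⟨y, rfl⟩ := toComplex.surjective y
    rw [toComplex.injective.mem_set_image, Set.mem_compl_iff, Set.mem_compl_iff,
      P.toComplex_mem_trace]
  have himg' : toComplex '' connectedComponentIn (P.boundary ℝ)ᶜ x =
      connectedComponentIn (trace (P.vertexSeq i) n)ᶜ (toComplex x) := by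
    rw [← hcompl]; exact himg
  rw [← himg'] at hb
  exact (toComplex.isometry.antilipschitz.isBounded_preimage hb).subset (Set.subset_preimage_image _ _)

/-- At a vertex turning in the sense of `σ`, the bisecting points are inside, so the interior angle
is the unoriented one, at most `π`. Reflexivity makes it exactly `π`; the edges are then collinear
and the exterior angle is `0`, a contradiction. -/
theorem IsReflex.mul_exteriorAngle_nonpos {P : Polygon Plane n} (hP : P.IsSimple) {i : Fin n}
    {σ : ℝ} (hσ : σ = 1 ∨ σ = -1)
    (hT : ∑ j ∈ Finset.range n, exteriorAngle (P.vertexSeq i) j = 2 * Real.pi * σ) {j : ℕ}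
    (h : P.IsReflex ((finRotate n)^[j + 1] i)) :
    σ * exteriorAngle (P.vertexSeq i) j ≤ 0 := by
  by_contra! hpos
  have hev := (hP.isSimpleClosed i).eventually_winding_ne_zero hσ hT j hpos
  have h0 : (finRotate n).symm ((finRotate n)^[j + 1] i) = (finRotate n)^[j] i := by
    rw [Function.iterate_succ_apply', Equiv.symm_apply_apply]
  have h2 : finRotate n ((finRotate n)^[j + 1] i) = (finRotate n)^[j + 2] i := by
    rw [← Function.iterate_succ_apply' (finRotate n)]
  rw [IsReflex, interiorAngle] at h
  simp only [h0, h2] at h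
  rw [if_pos] at h
  · have hpi := le_antisymm (InnerProductGeometry.angle_le_pi _ _) h
    obtain ⟨hne, r, hr, hrv⟩ := InnerProductGeometry.angle_eq_pi_iff.1 hpi
    have hz : P.vertexSeq i (j + 2) - P.vertexSeq i (j + 1) =
        ((-r : ℝ) : ℂ) * (P.vertexSeq i (j + 1) - P.vertexSeq i j) := by
      have := congrArg toComplex hrv
      rw [map_smul, vsub_eq_sub, vsub_eq_sub, map_sub, map_sub, Complex.real_smul] at this
      simp only [vertexSeq]
      rw [this]; push_cast; ring
    have h0 : exteriorAngle (P.vertexSeq i) j = 0 := by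
      rw [exteriorAngle, hz, turn_real_mul_right (by linarith), turn, Complex.arg_div_self]
    rw [h0, mul_zero] at hpos
    exact lt_irrefl _ hpos
  · filter_upwards [hev] with t ht
    apply P.mem_inside_of_winding_ne_zero i <;>
    · rw [h0, h2, map_add, map_smul, map_add, map_sub, map_sub, Complex.real_smul]
      first
      | exact ht.1
      | exact ht.2

theorem stronglyVisible_of_sees {P : Polygon Plane n} {i : Fin n} {p q : Plane}
    (hp : p ∈ P.boundary ℝ) (hq : q ∈ P.boundary ℝ)
    (h : Sees (P.vertexSeq i) n (toComplex p) (toComplex q)) : P.StronglyVisible p q := by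
  have key : ∀ x ∈ segment ℝ p q, x = p ∨ x = q ∨ (x ∉ P.boundary ℝ ∧ x ∈ P.inside) := by
    intro x hx
    obtain ⟨t, h0, h1, ht⟩ := exists_of_mem_segment (toComplex_mem_segment.2 hx)
    rcases h0.lt_or_eq with h0 | rfl
    · rcases h1.lt_or_eq with h1 | rfl
      · have := h t h0 h1
        rw [← ht] at this
        exact Or.inr (Or.inr ⟨fun hb => this.1 ((P.toComplex_mem_trace i x).2 hb),
          P.mem_inside_of_winding_ne_zero i this.1 this.2⟩)
      · right; left
        apply toComplex.injective
        rw [ht]; push_cast; ring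
    · left
      apply toComplex.injective
      rw [ht]; push_cast; ring
  refine ⟨fun x hx => ?_, ?_⟩
  · rcases key x hx with rfl | rfl | h
    · exact Or.inl hp
    · exact Or.inl hq
    · exact Or.inr h.2
  · ext x
    constructor
    · rintro ⟨hx, hb⟩
      rcases key x hx with rfl | rfl | h
      · exact Or.inl rfl
      · exact Or.inr rfl
      · exact absurd hb h.1
    · rintro (rfl | rfl)
      · exact ⟨left_mem_segment ℝ _ _, hp⟩
      · exact ⟨right_mem_segment ℝ _ _, hq⟩

/-! ### Boundary paths and their cyclic order -/

namespace BoundaryPath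

variable {P : Polygon Plane n}

theorem mem_carrier {B : P.BoundaryPath} {x : Plane} :
    x ∈ B.carrier ↔ ∃ j < B.length, x ∈ P.edgeSet ℝ (B.index j) := by
  simp [carrier]

theorem index_add (B : P.BoundaryPath) (j k : ℕ) :
    B.index (j + k) = (finRotate n)^[k] (B.index j) := by
  rw [index, index, ← Function.iterate_add_apply, add_comm]

theorem carrier_subset_boundary (B : P.BoundaryPath) : B.carrier ⊆ P.boundary ℝ := by
  intro x hx
  obtain ⟨j, -, hj⟩ := mem_carrier.1 hx
  exact Set.mem_iUnion.2 ⟨_, hj⟩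

theorem vertices_start_mem (B : P.BoundaryPath) : P.vertices B.start ∈ B.carrier := by
  refine mem_carrier.2 ⟨0, B.length_pos, ?_⟩
  rw [edgeSet_eq]
  exact left_mem_segment ℝ _ _

theorem vertices_end_mem (B : P.BoundaryPath) : P.vertices (B.index B.length) ∈ B.carrier := by
  refine mem_carrier.2 ⟨B.length - 1, Nat.sub_lt B.length_pos one_pos, ?_⟩
  rw [edgeSet_eq]
  have : B.index B.length = finRotate n (B.index (B.length - 1)) := by
    conv_lhs => rw [← Nat.sub_add_cancel B.length_pos, index_add]
    rfl
  rw [this]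
  exact right_mem_segment ℝ _ _

/-- Vertices are numbered from the start of the path containing `p`, so that the three paths become
the index ranges of `exists_sees`. An interior point of the first path avoids the other two, since
each meets the first only at a shared endpoint. -/
theorem exists_stronglyVisible (hP : P.IsSimple) {B₁ B₂ B₃ : P.BoundaryPath}
    (h12 : B₂.start = B₁.index B₁.length) (h23 : B₃.start = B₂.index B₂.length)
    (hlen : B₁.length + B₂.length + B₃.length = n)
    (hi12 : (B₁.carrier ∩ B₂.carrier).Subsingleton) (hi13 : (B₁.carrier ∩ B₃.carrier).Subsingleton)
    (hc₁ : B₁.IsOutwardConvex) (hc₂ : B₂.IsOutwardConvex) (hc₃ : B₃.IsOutwardConvex)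
    {p : Plane} (hp : p ∈ B₁.interiorPoints) :
    (∃ q ∈ B₂.interiorPoints, P.StronglyVisible p q) ∧
      ∃ q ∈ B₃.interiorPoints, P.StronglyVisible p q := by
  have hl₁ := B₁.length_pos
  have hl₂ := B₂.length_pos
  have hl₃ := B₃.length_pos
  have hi₂ : ∀ t, B₂.index t = B₁.index (B₁.length + t) := by
    intro t; rw [index_add, ← h12]; rfl
  have hi₃ : ∀ t, B₃.index t = B₁.index (B₁.length + B₂.length + t) := by
    intro t; rw [index_add, ← hi₂, ← h23]; rfl
  have hin : B₁.index (B₁.length + B₂.length + B₃.length) = B₁.index 0 :=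
    (iterate_finRotate_eq_iff B₁.start _ 0).2 (by simp [hlen])
  obtain ⟨hpB, hpe⟩ := hp
  rw [Set.mem_insert_iff, Set.mem_singleton_iff, not_or] at hpe
  have hS := hP.isSimpleClosed B₁.start
  obtain ⟨σ, hσ, hT⟩ := hS.exists_total_turning_eq
  obtain ⟨k, hk, hpk⟩ := mem_carrier.1 hpB
  have hmem : ∀ j x, toComplex x ∈ segment ℝ (P.vertexSeq B₁.start j) (P.vertexSeq B₁.start (j + 1)) ↔
      x ∈ P.edgeSet ℝ (B₁.index j) := fun j x => P.toComplex_mem_vertexSeq B₁.start j x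
  have hmem₂ : ∀ j x, B₁.length ≤ j → j < B₁.length + B₂.length → x ∈ P.edgeSet ℝ (B₁.index j) →
      x ∈ B₂.carrier := by
    intro j x h1 h2 hx
    refine mem_carrier.2 ⟨j - B₁.length, by omega, ?_⟩
    rwa [hi₂, Nat.add_sub_cancel' h1]
  have hmem₃ : ∀ j x, B₁.length + B₂.length ≤ j → j < n → x ∈ P.edgeSet ℝ (B₁.index j) →
      x ∈ B₃.carrier := by
    intro j x h1 h2 hx
    refine mem_carrier.2 ⟨j - (B₁.length + B₂.length), by omega, ?_⟩
    rwa [hi₃, Nat.add_sub_cancel' h1]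
  have hreflex : ∀ j, j + 1 < n → j + 1 ≠ B₁.length → j + 1 ≠ B₁.length + B₂.length →
      σ * exteriorAngle (P.vertexSeq B₁.start) j ≤ 0 := by
    intro j h1 h2 h3
    refine IsReflex.mul_exteriorAngle_nonpos hP hσ hT ?_
    change P.IsReflex (B₁.index (j + 1))
    rcases Nat.lt_or_ge (j + 1) B₁.length with h4 | h4
    · exact hc₁ _ (by omega) h4
    rcases Nat.lt_or_ge (j + 1) (B₁.length + B₂.length) with h5 | h5
    · have := hc₂ (j + 1 - B₁.length) (by omega) (by omega)
      rwa [hi₂, Nat.add_sub_cancel' h4] at this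
    · have := hc₃ (j + 1 - (B₁.length + B₂.length)) (by omega) (by omega)
      rwa [hi₃, Nat.add_sub_cancel' h5] at this
  have hout : ∀ j, B₁.length ≤ j → j < n →
      toComplex p ∉ segment ℝ (P.vertexSeq B₁.start j) (P.vertexSeq B₁.start (j + 1)) := by
    intro j h1 h2 hx
    rw [hmem] at hx
    rcases Nat.lt_or_ge j (B₁.length + B₂.length) with h3 | h3
    · apply hpe.2
      refine hi12 ⟨hpB, hmem₂ j p h1 h3 hx⟩ ⟨B₁.vertices_end_mem, ?_⟩
      rw [← h12]
      exact B₂.vertices_start_mem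
    · apply hpe.1
      refine hi13 ⟨hpB, hmem₃ j p h3 h2 hx⟩ ⟨B₁.vertices_start_mem, ?_⟩
      rw [← hin, ← hi₃]
      exact B₃.vertices_end_mem
  obtain ⟨⟨q, j, hj1, hj2, hq, hq1, hq2, hsee⟩, ⟨q', j', hj1', hj2', hq', hq1', hq2', hsee'⟩⟩ :=
    hS.exists_sees hσ hT hl₁ (by omega : B₁.length < B₁.length + B₂.length) (by omega) hreflex hk
      ((hmem k p).2 hpk) hout
  obtain ⟨q, rfl⟩ := toComplex.surjective q
  obtain ⟨q', rfl⟩ := toComplex.surjective q'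
  have hpb := B₁.carrier_subset_boundary hpB
  have hqB := hmem₂ j q hj1 hj2 ((hmem j q).1 hq)
  have hqB' := hmem₃ j' q' hj1' hj2' ((hmem j' q').1 hq')
  refine ⟨⟨q, ⟨hqB, ?_⟩, stronglyVisible_of_sees hpb (B₂.carrier_subset_boundary hqB) hsee⟩,
    ⟨q', ⟨hqB', ?_⟩, stronglyVisible_of_sees hpb (B₃.carrier_subset_boundary hqB') hsee'⟩⟩
  · rw [hi₂, hi₂]
    rintro (h | h)
    · exact hq1 (congrArg toComplex h)
    · exact hq2 (congrArg toComplex h)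
  · rw [hi₃, hi₃, hlen]
    rintro (h | h)
    · exact hq1' (congrArg toComplex h)
    · exact hq2' (congrArg toComplex h)

theorem eq_of_mem_edgeSet_midpoint (hP : P.IsSimple) {e e' : Fin n}
    (h : midpoint ℝ (P.vertices e) (P.vertices (finRotate n e)) ∈ P.edgeSet ℝ e') : e = e' := by
  have hne := hP.nondegenerate e
  have hmem : midpoint ℝ (P.vertices e) (P.vertices (finRotate n e)) ∈ P.edgeSet ℝ e := by
    rw [edgeSet_eq]; exact midpoint_mem_segment _ _
  by_contra hee
  by_cases h1 : e' = finRotate n e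
  · subst h1
    have := (hP.consecutive e).subset ⟨hmem, h⟩
    exact hne ((midpoint_eq_right_iff ℝ).1 this)
  by_cases h2 : e = finRotate n e'
  · have := (hP.consecutive e').subset ⟨h, h2 ▸ hmem⟩
    rw [← h2] at this
    exact hne ((midpoint_eq_left_iff ℝ).1 this)
  exact Set.disjoint_left.1 (hP.nonconsecutive e e' hee h1 h2) hmem h

end BoundaryPath

/-- Three nonempty cyclic intervals that partition `ℤ/n`, the first of which starts at `0`. -/
theorem cyclic_intervals {n L a la b lb : ℕ} (hL : 0 < L) (hLn : L < n) (ha : a < n) (hb : b < n)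
    (hla : 0 < la) (hlb : 0 < lb)
    (hda : ∀ t < la, ∀ u < L, (a + t) % n ≠ u) (hdb : ∀ t < lb, ∀ u < L, (b + t) % n ≠ u)
    (hdab : ∀ t < la, ∀ u < lb, (a + t) % n ≠ (b + u) % n)
    (hcov : ∀ x < n, x < L ∨ (∃ t < la, (a + t) % n = x) ∨ ∃ t < lb, (b + t) % n = x) :
    (a = L ∧ b = L + la ∧ L + la + lb = n) ∨ (b = L ∧ a = L + lb ∧ L + lb + la = n) := by
  have key : ∀ c lc, c < n → 0 < lc → (∀ t < lc, ∀ u < L, (c + t) % n ≠ u) → L ≤ c ∧ c + lc ≤ n := by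
    intro c lc hc hlc hd
    constructor
    · by_contra! hlt
      exact hd 0 hlc c hlt (by rw [add_zero, Nat.mod_eq_of_lt hc])
    · by_contra! hlt
      exact hd (n - c) (by omega) 0 hL (by rw [Nat.add_sub_cancel' hc.le, Nat.mod_self])
  obtain ⟨ha1, ha2⟩ := key a la ha hla hda
  obtain ⟨hb1, hb2⟩ := key b lb hb hlb hdb
  have hcov' : ∀ x < n, x < L ∨ (a ≤ x ∧ x < a + la) ∨ (b ≤ x ∧ x < b + lb) := by
    intro x hx
    rcases hcov x hx with h | ⟨t, ht, h⟩ | ⟨t, ht, h⟩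
    · exact Or.inl h
    · rw [Nat.mod_eq_of_lt (by omega)] at h; omega
    · rw [Nat.mod_eq_of_lt (by omega)] at h; omega
  have hdis : ∀ x, ¬ ((a ≤ x ∧ x < a + la) ∧ (b ≤ x ∧ x < b + lb)) := by
    rintro x ⟨h1, h2⟩
    apply hdab (x - a) (by omega) (x - b) (by omega)
    congr 1; omega
  -- No interval wraps around, since `0` belongs to the first. Testing coverage at `L`, at `n - 1`
  -- and just past the earlier of the other two intervals leaves no room for gaps.
  have c1 := hcov' L hLn
  have c2 := hcov' (n - 1) (by omega)
  have d1 := hdis a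
  have d2 := hdis b
  rcases Nat.lt_or_ge a b with h | h
  · have c3 := hcov' (a + la) (by omega)
    omega
  · have c3 := fun h => hcov' (b + lb) h
    omega

end Polygon

theorem proposition2p7 {n : ℕ} (P : Polygon Plane n) (hP : P.IsSimple)
    (B : Fin 3 → P.BoundaryPath) (v : Fin 3 → Fin n)
    (hv : Function.Injective v)
    (hunion : ⋃ k, (B k).carrier = P.boundary ℝ)
    (hinter : ∀ k : Fin 3, (B k).carrier ∩ (B (k + 1)).carrier = {P.vertices (v k)})
    (hconvex : ∀ k : Fin 3, (B k).IsOutwardConvex) :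
    ∀ i j : Fin 3, i ≠ j → ∀ p ∈ (B i).interiorPoints,
      ∃ q ∈ (B j).interiorPoints, P.StronglyVisible p q := by
  intro i j hij p hp
  have hsub : ∀ k l, k ≠ l → ((B k).carrier ∩ (B l).carrier).Subsingleton := by
    intro k l hkl
    have : l = k + 1 ∨ k = l + 1 := by revert k l; decide
    rcases this with rfl | rfl
    · rw [hinter]; exact Set.subsingleton_singleton
    · rw [Set.inter_comm, hinter]; exact Set.subsingleton_singleton
  obtain ⟨m, hmi, hmj, hall⟩ : ∃ m, m ≠ i ∧ m ≠ j ∧ ∀ l, l = i ∨ l = j ∨ l = m := by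
    clear hp; revert i j; decide
  -- A shared edge would give two paths two distinct common points, its endpoints.
  have hdisj : ∀ k l, k ≠ l → ∀ t < (B k).length, ∀ u < (B l).length,
      (B k).index t ≠ (B l).index u := by
    intro k l hkl t ht u hu he
    have hsubset : ∀ x ∈ P.edgeSet ℝ ((B k).index t), x ∈ (B k).carrier ∩ (B l).carrier :=
      fun x hx => ⟨Polygon.BoundaryPath.mem_carrier.2 ⟨t, ht, hx⟩,
        Polygon.BoundaryPath.mem_carrier.2 ⟨u, hu, he ▸ hx⟩⟩
    rw [Polygon.edgeSet_eq] at hsubset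
    exact hP.nondegenerate _ (hsub k l hkl (hsubset _ (left_mem_segment ℝ _ _))
      (hsubset _ (right_mem_segment ℝ _ _)))
  -- The midpoint of an edge lies on no other edge, so the path that covers the midpoint contains
  -- the edge.
  have hcover : ∀ e : Fin n, ∃ k, ∃ t < (B k).length, (B k).index t = e := by
    intro e
    have hmem : midpoint ℝ (P.vertices e) (P.vertices (finRotate n e)) ∈ P.boundary ℝ := by
      refine Set.mem_iUnion.2 ⟨e, ?_⟩
      rw [Polygon.edgeSet_eq]
      exact midpoint_mem_segment _ _
    rw [← hunion] at hmem
    obtain ⟨k, hk⟩ := Set.mem_iUnion.1 hmem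
    obtain ⟨t, ht, h⟩ := Polygon.BoundaryPath.mem_carrier.1 hk
    exact ⟨k, t, ht, (Polygon.BoundaryPath.eq_of_mem_edgeSet_midpoint hP h).symm⟩
  obtain ⟨a, ha, hja⟩ := Polygon.exists_iterate_finRotate_eq (B i).start (B j).start
  obtain ⟨b, hb, hmb⟩ := Polygon.exists_iterate_finRotate_eq (B i).start (B m).start
  have hij' : ∀ t, (B j).index t = (B i).index (a + t) := by
    intro t
    rw [Polygon.BoundaryPath.index_add]
    exact congrArg _ hja.symm
  have him' : ∀ t, (B m).index t = (B i).index (b + t) := by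
    intro t
    rw [Polygon.BoundaryPath.index_add]
    exact congrArg _ hmb.symm
  have hmod : ∀ s t, (B i).index s = (B i).index t ↔ s % n = t % n :=
    Polygon.iterate_finRotate_eq_iff _
  have hLn := (B i).length_lt
  -- The labels of the paths need not follow the vertex numbering. Either `B j` or `B m` comes
  -- directly after `B i`, and this decides which half of `exists_stronglyVisible` applies.
  rcases Polygon.cyclic_intervals (B i).length_pos hLn ha hb (B j).length_pos (B m).length_pos
    (fun t ht u hu he => hdisj j i hij.symm t ht u hu (by
      rw [hij', hmod, he, Nat.mod_eq_of_lt (by omega)]))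
    (fun t ht u hu he => hdisj m i hmi t ht u hu (by
      rw [him', hmod, he, Nat.mod_eq_of_lt (by omega)]))
    (fun t ht u hu he => hdisj j m hmj.symm t ht u hu (by rw [hij', him', hmod, he]))
    (fun x hx => by
      obtain ⟨k, t, ht, hk⟩ := hcover ((B i).index x)
      rcases hall k with rfl | rfl | rfl
      · left
        rw [hmod, Nat.mod_eq_of_lt hx, Nat.mod_eq_of_lt (by omega)] at hk
        omega
      · right; left
        rw [hij', hmod, Nat.mod_eq_of_lt hx] at hk
        exact ⟨t, ht, hk⟩
      · right; right
        rw [him', hmod, Nat.mod_eq_of_lt hx] at hk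
        exact ⟨t, ht, hk⟩) with ⟨h1, h2, h3⟩ | ⟨h1, h2, h3⟩
  · refine (Polygon.BoundaryPath.exists_stronglyVisible hP (B₁ := B i) (B₂ := B j) (B₃ := B m)
      ?_ ?_ h3 (hsub i j hij) (hsub i m hmi.symm) (hconvex i) (hconvex j) (hconvex m) hp).1
    · rw [← hja, h1]; rfl
    · rw [← hmb, hij', h1, h2]; rfl
  · refine (Polygon.BoundaryPath.exists_stronglyVisible hP (B₁ := B i) (B₂ := B m) (B₃ := B j)
      ?_ ?_ h3 (hsub i m hmi.symm) (hsub i j hij) (hconvex i) (hconvex m) (hconvex j) hp).2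
    · rw [← hmb, h1]; rfl
    · rw [← hja, him', h1, h2]; rfl
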